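/- Let $X$ be a complex Banach space, $p\in(1,\infty)$, $r>0$. Let $A:D(A)\subset X\to X$ be the generator of a strongly continuous semigroup on $X$, let $a\in W^{1,p}(\mathbb{R}_+,\mathbb{C})$ with Laplace transform $\hat a(\lambda)=\int_0^\infty e^{-\lambda t}a(t)\,dt$, and let $\mu:[-r,0]\to\mathcal{L}(X)$ be of bounded variation, continuous at $0$, with total variation on $[-\varepsilon,0]$ tending to $0$ as $\varepsilon\to0^+$. Let $L\varphi=\int_{-r}^0 d\mu(\theta)\,\varphi(\theta)$ (Riemann–Stieltjes integral) for $\varphi\in W^{1,p}([-r,0],X)$, and for $\lambda\in\mathbb{C}$ let $Le_\lambda\in\mathcal{L}(X)$ be the operator $x\mapsto L(e^{\lambda\cdot}x)$. For a closed operator $T$ on a Banach space, $\rho(T)$ denotes the set of $\lambda\in\mathbb{C}$ such that $\lambda-T:D(T)\to E$ is bijective onto the space $E$ (equivalently, has a bounded everywhere defined inverse). On $X\times L^p(\mathbb{R}_+,X)$ consider the operators with common domain $D(A)\times W^{1,p}(\mathbb{R}_+,X)$ $$\mathcal{A}_0\begin{pmatrix}x\\f\end{pmatrix}=\begin{pmatrix}Ax+f(0)\\f'\end{pmatrix},\qquad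 \mathcal{A}^{\delta_0}\begin{pmatrix}x\\f\end{pmatrix}=\begin{pmatrix}Ax+f(0)\\a(\cdot)Ax+f'\end{pmatrix},$$ and on $X\times L^p(\mathbb{R}_+,X)\times L^p([-r,0],X)$ consider the operator $$\mathfrak{A}_L\begin{pmatrix}x\\f\\\varphi\end{pmatrix}=\begin{pmatrix}Ax+f(0)+L\varphi\\a(\cdot)Ax+f'\\\varphi'\end{pmatrix},$$ $$D(\mathfrak{A}_L)=\{(x,f,\varphi)\in D(A)\times W^{1,p}(\mathbb{R}_+,X)\times W^{1,p}([-r,0],X):\varphi(0)=x\}.$$ Let $\lambda\in\mathbb{C}$ with $\operatorname{Re}\lambda>0$ and $\lambda\in\rho(\mathcal{A}^{\delta_0})\cap\rho(\mathcal{A}_0)$. Then $$\lambda\in\rho(\mathfrak{A}_L)\iff\lambda\in\rho\big((1+\hat a(\lambda))A+Le_\lambda\big),$$ where $(1+\hat a(\lambda))A+Le_\lambda$ has domain $D(A)$. -/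

import Mathlib

open Set Filter Topology MeasureTheory
open scoped ENNReal

noncomputable section

namespace DelayVolterra

/-! ### Riemann–Stieltjes integrals of operator-valued functions of bounded variation -/

section Stieltjes

variable {X : Type*} [NormedAddCommGroup X] [NormedSpace ℂ X]

/-- A tagged division `a = pt 0 ≤ pt 1 ≤ ⋯ ≤ pt n = b` with tags `tag i ∈ [pt i, pt (i+1)]`
for `i < n` (the values of `pt` beyond `n` and of `tag` from `n` on play no role). -/
structure TaggedDivision (a b : ℝ) where
  n : ℕ
  pt : ℕ → ℝ
  tag : ℕ → ℝ
  mono : Monotone pt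
  pt_zero : pt 0 = a
  pt_n : pt n = b
  tag_mem : ∀ i < n, tag i ∈ Icc (pt i) (pt (i + 1))

lemma TaggedDivision.pt_mem {a b : ℝ} (P : TaggedDivision a b) {i : ℕ} (hi : i ≤ P.n) :
    P.pt i ∈ Icc a b := by
  constructor
  · exact P.pt_zero.symm.le.trans (P.mono (Nat.zero_le _))
  · exact (P.mono hi).trans P.pt_n.le

/-- All subintervals of the division are shorter than `δ`. -/
def TaggedDivision.MeshLT {a b : ℝ} (P : TaggedDivision a b) (δ : ℝ) : Prop :=
  ∀ i < P.n, P.pt (i + 1) - P.pt i < δ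

/-- The Riemann–Stieltjes sum `∑ (μ(t_{i+1}) - μ(t_i)) φ(ξ_i)`. -/
def rsSum (μ : ℝ → X →L[ℂ] X) (φ : ℝ → X) {a b : ℝ} (P : TaggedDivision a b) : X :=
  ∑ i ∈ Finset.range P.n, (μ (P.pt (i + 1)) - μ (P.pt i)) (φ (P.tag i))

/-- `y` is the Riemann–Stieltjes integral `∫_a^b dμ(θ) φ(θ)`: the limit of the Riemann–Stieltjes
sums as the mesh tends to zero. -/
def HasRSIntegral (μ : ℝ → X →L[ℂ] X) (φ : ℝ → X) (a b : ℝ) (y : X) : Prop :=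
  ∀ ε > 0, ∃ δ > 0, ∀ P : TaggedDivision a b, P.MeshLT δ → ‖rsSum μ φ P - y‖ < ε

open Classical in
/-- The Riemann–Stieltjes integral `∫_a^b dμ(θ) φ(θ)` (and `0` if it does not exist). -/
def rsIntegral (μ : ℝ → X →L[ℂ] X) (φ : ℝ → X) (a b : ℝ) : X :=
  if h : ∃ y, HasRSIntegral μ φ a b y then h.choose else 0

/-- The division of `[a, b]` into `n + 1` equal parts, tagged at the left end points. -/
def equalDivision {a b : ℝ} (hab : a ≤ b) (n : ℕ) : TaggedDivision a b where
  n := n + 1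
  pt i := a + i * ((b - a) / (n + 1))
  tag i := a + i * ((b - a) / (n + 1))
  mono := by
    intro i j hij
    have h1 : (i : ℝ) ≤ j := by exact_mod_cast hij
    have h2 : 0 ≤ (b - a) / ((n : ℝ) + 1) := div_nonneg (by linarith) (by positivity)
    have := mul_le_mul_of_nonneg_right h1 h2
    simpa using this
  pt_zero := by simp
  pt_n := by
    have : ((n : ℝ) + 1) ≠ 0 := by positivity
    push_cast
    field_simp
    ring
  tag_mem := by
    intro i _
    have h2 : 0 ≤ (b - a) / ((n : ℝ) + 1) := div_nonneg (by linarith) (by positivity)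
    refine ⟨le_rfl, ?_⟩
    push_cast
    nlinarith

lemma exists_equalDivision_meshLT {a b : ℝ} (hab : a ≤ b) {δ : ℝ} (hδ : 0 < δ) :
    ∃ N, ∀ n ≥ N, (equalDivision hab n).MeshLT δ := by
  obtain ⟨N, hN⟩ := exists_nat_gt ((b - a) / δ)
  refine ⟨N, fun n hn i _ => ?_⟩
  have hn' : (N : ℝ) ≤ n := by exact_mod_cast hn
  have h3 : (b - a) / ((n : ℝ) + 1) < δ := by
    rw [div_lt_iff₀ (by positivity)]
    rw [div_lt_iff₀ hδ] at hN
    nlinarith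
  simp only [equalDivision]
  push_cast
  linarith

lemma HasRSIntegral.unique {μ : ℝ → X →L[ℂ] X} {φ : ℝ → X} {a b : ℝ} (hab : a ≤ b) {y z : X}
    (hy : HasRSIntegral μ φ a b y) (hz : HasRSIntegral μ φ a b z) : y = z := by
  by_contra hne
  have hpos : 0 < ‖y - z‖ / 2 := by
    have := norm_pos_iff.2 (sub_ne_zero.2 hne)
    linarith
  obtain ⟨δ₁, hδ₁, h₁⟩ := hy _ hpos
  obtain ⟨δ₂, hδ₂, h₂⟩ := hz _ hpos
  obtain ⟨N₁, hN₁⟩ := exists_equalDivision_meshLT hab hδ₁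
  obtain ⟨N₂, hN₂⟩ := exists_equalDivision_meshLT hab hδ₂
  have e₁ := h₁ _ (hN₁ (max N₁ N₂) (le_max_left _ _))
  have e₂ := h₂ _ (hN₂ (max N₁ N₂) (le_max_right _ _))
  rw [norm_sub_rev] at e₁
  have := norm_sub_le_norm_sub_add_norm_sub y (rsSum μ φ (equalDivision hab (max N₁ N₂))) z
  linarith

lemma HasRSIntegral.rsIntegral_eq {μ : ℝ → X →L[ℂ] X} {φ : ℝ → X} {a b : ℝ} (hab : a ≤ b) {y : X}
    (hy : HasRSIntegral μ φ a b y) : rsIntegral μ φ a b = y := by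
  have h : ∃ y, HasRSIntegral μ φ a b y := ⟨y, hy⟩
  rw [rsIntegral, dif_pos h]
  exact h.choose_spec.unique hab hy

lemma HasRSIntegral.add {μ : ℝ → X →L[ℂ] X} {φ ψ : ℝ → X} {a b : ℝ} {y z : X}
    (hy : HasRSIntegral μ φ a b y) (hz : HasRSIntegral μ ψ a b z) :
    HasRSIntegral μ (fun t => φ t + ψ t) a b (y + z) := by
  intro ε hε
  obtain ⟨δ₁, hδ₁, h₁⟩ := hy _ (half_pos hε)
  obtain ⟨δ₂, hδ₂, h₂⟩ := hz _ (half_pos hε)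
  refine ⟨min δ₁ δ₂, lt_min hδ₁ hδ₂, fun P hP => ?_⟩
  have e₁ := h₁ P fun i hi => (hP i hi).trans_le (min_le_left _ _)
  have e₂ := h₂ P fun i hi => (hP i hi).trans_le (min_le_right _ _)
  have : rsSum μ (fun t => φ t + ψ t) P - (y + z) = (rsSum μ φ P - y) + (rsSum μ ψ P - z) := by
    simp only [rsSum, map_add, Finset.sum_add_distrib]
    abel
  rw [this]
  exact (norm_add_le _ _).trans_lt (by linarith)

lemma HasRSIntegral.smul {μ : ℝ → X →L[ℂ] X} {φ : ℝ → X} {a b : ℝ} {y : X} (c : ℂ)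
    (hy : HasRSIntegral μ φ a b y) : HasRSIntegral μ (fun t => c • φ t) a b (c • y) := by
  intro ε hε
  obtain ⟨δ, hδ, h⟩ := hy (ε / (‖c‖ + 1)) (by positivity)
  refine ⟨δ, hδ, fun P hP => ?_⟩
  have : rsSum μ (fun t => c • φ t) P - c • y = c • (rsSum μ φ P - y) := by
    simp only [rsSum, map_smul, Finset.smul_sum, smul_sub]
  rw [this, norm_smul]
  have e := h P hP
  rw [lt_div_iff₀ (by positivity)] at e
  nlinarith [norm_nonneg (rsSum μ φ P - y)]

/-- Only the values of the integrand on `[a, b]` matter. -/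
lemma HasRSIntegral.congr {μ : ℝ → X →L[ℂ] X} {φ ψ : ℝ → X} {a b : ℝ} {y : X}
    (hy : HasRSIntegral μ φ a b y) (h : ∀ t ∈ Icc a b, φ t = ψ t) :
    HasRSIntegral μ ψ a b y := by
  intro ε hε
  obtain ⟨δ, hδ, h'⟩ := hy ε hε
  refine ⟨δ, hδ, fun P hP => ?_⟩
  have : rsSum μ ψ P = rsSum μ φ P := by
    refine Finset.sum_congr rfl fun i hi => ?_
    have hi := Finset.mem_range.1 hi
    have ht := P.tag_mem i hi
    rw [h _ ⟨(P.pt_mem hi.le).1.trans ht.1, ht.2.trans (P.pt_mem hi).2⟩]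
  rw [this]
  exact h' P hP

/-- `x` clamped to the interval `[l, u]`. -/
def clampIcc (l u x : ℝ) : ℝ := max l (min u x)

lemma clampIcc_symm (m : ℝ → X →L[ℂ] X) {l u l' u' : ℝ} (h : l ≤ u) (h' : l' ≤ u') :
    m (clampIcc l u u') - m (clampIcc l u l') = m (clampIcc l' u' u) - m (clampIcc l' u' l) := by
  unfold clampIcc
  rcases le_total u l' with h1 | h1
  · have : max l (min u u') = max l (min u l') := by grind
    have : max l' (min u' u) = max l' (min u' l) := by grind
    simp_all
  rcases le_total u' l with h2 | h2
  · have : max l (min u u') = max l (min u l') := by grind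
    have : max l' (min u' u) = max l' (min u' l) := by grind
    simp_all
  · have h3 : max l (min u u') = max l' (min u' u) := by grind
    have h4 : max l (min u l') = max l' (min u' l) := by grind
    rw [h3, h4]

lemma clampIcc_mono {l u x y : ℝ} (h : x ≤ y) : clampIcc l u x ≤ clampIcc l u y :=
  max_le_max le_rfl (min_le_min le_rfl h)

lemma clampIcc_mem {l u : ℝ} (h : l ≤ u) (x : ℝ) : clampIcc l u x ∈ Icc l u :=
  ⟨le_max_left _ _, max_le h (min_le_left _ _)⟩

lemma rsSum_row (m : ℝ → X →L[ℂ] X) {a b : ℝ} (Q : TaggedDivision a b) {l u : ℝ}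
    (hl : a ≤ l) (h : l ≤ u) (hu : u ≤ b) :
    ∑ j ∈ Finset.range Q.n, (m (clampIcc l u (Q.pt (j + 1))) - m (clampIcc l u (Q.pt j))) =
      m u - m l := by
  rw [Finset.sum_range_sub (fun j => m (clampIcc l u (Q.pt j))), Q.pt_n, Q.pt_zero]
  congr 2 <;> · unfold clampIcc; grind

/-- Riemann–Stieltjes sums over two fine divisions differ by at most `ε` times the variation. -/
lemma norm_rsSum_sub_le {μ : ℝ → X →L[ℂ] X} {φ : ℝ → X} {a b : ℝ}
    (hμ : BoundedVariationOn μ (Icc a b)) {ε δ : ℝ} (hε : 0 ≤ ε)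
    (hφ : ∀ x ∈ Icc a b, ∀ y ∈ Icc a b, |x - y| < 2 * δ → ‖φ x - φ y‖ ≤ ε)
    {P Q : TaggedDivision a b} (hP : P.MeshLT δ) (hQ : Q.MeshLT δ) :
    ‖rsSum μ φ P - rsSum μ φ Q‖ ≤ ε * (eVariationOn μ (Icc a b)).toReal := by
  let D : ℕ → ℕ → X →L[ℂ] X := fun i j =>
    μ (clampIcc (P.pt i) (P.pt (i + 1)) (Q.pt (j + 1))) - μ (clampIcc (P.pt i) (P.pt (i + 1)) (Q.pt j))
  have hPm : ∀ i, P.pt i ≤ P.pt (i + 1) := fun i => P.mono (Nat.le_succ i)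
  have hQm : ∀ i, Q.pt i ≤ Q.pt (i + 1) := fun i => Q.mono (Nat.le_succ i)
  have hrow : ∀ i < P.n, ∑ j ∈ Finset.range Q.n, D i j = μ (P.pt (i + 1)) - μ (P.pt i) :=
    fun i hi => rsSum_row μ Q (P.pt_mem hi.le).1 (hPm i) (P.pt_mem hi).2
  have hcol : ∀ j < Q.n, ∑ i ∈ Finset.range P.n, D i j = μ (Q.pt (j + 1)) - μ (Q.pt j) := by
    intro j hj
    rw [← rsSum_row μ P (Q.pt_mem hj.le).1 (hQm j) (Q.pt_mem hj).2]
    exact Finset.sum_congr rfl fun i _ => clampIcc_symm μ (hPm i) (hQm j)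
  have hsP : rsSum μ φ P =
      ∑ i ∈ Finset.range P.n, ∑ j ∈ Finset.range Q.n, D i j (φ (P.tag i)) := by
    refine Finset.sum_congr rfl fun i hi => ?_
    rw [← hrow i (Finset.mem_range.1 hi), sum_apply]
  have hsQ : rsSum μ φ Q =
      ∑ i ∈ Finset.range P.n, ∑ j ∈ Finset.range Q.n, D i j (φ (Q.tag j)) := by
    rw [Finset.sum_comm]
    refine Finset.sum_congr rfl fun j hj => ?_
    rw [← hcol j (Finset.mem_range.1 hj), sum_apply]
  have hterm : ∀ i < P.n, ∀ j < Q.n, ‖D i j (φ (P.tag i) - φ (Q.tag j))‖ ≤ ε * ‖D i j‖ := by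
    intro i hi j hj
    have hti := P.tag_mem i hi
    have htj := Q.tag_mem j hj
    have hmi := hP i hi
    have hmj := hQ j hj
    rcases lt_or_ge (P.pt (i + 1)) (Q.pt j) with h1 | h1
    · have : D i j = 0 := by
        have : clampIcc (P.pt i) (P.pt (i + 1)) (Q.pt (j + 1)) =
            clampIcc (P.pt i) (P.pt (i + 1)) (Q.pt j) := by
          have := hQm j
          unfold clampIcc
          grind
        simp [D, this]
      simp [this]
    rcases lt_or_ge (Q.pt (j + 1)) (P.pt i) with h2 | h2
    · have : D i j = 0 := by
        have : clampIcc (P.pt i) (P.pt (i + 1)) (Q.pt (j + 1)) =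
            clampIcc (P.pt i) (P.pt (i + 1)) (Q.pt j) := by
          have := hQm j
          unfold clampIcc
          grind
        simp [D, this]
      simp [this]
    have hi0 := P.pt_mem hi.le
    have hi1 := P.pt_mem (Nat.succ_le_of_lt hi)
    have hj0 := Q.pt_mem hj.le
    have hj1 := Q.pt_mem (Nat.succ_le_of_lt hj)
    have h3 : ‖φ (P.tag i) - φ (Q.tag j)‖ ≤ ε := by
      refine hφ _ ⟨hi0.1.trans hti.1, hti.2.trans hi1.2⟩ _ ⟨hj0.1.trans htj.1, htj.2.trans hj1.2⟩ ?_
      rw [abs_lt]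
      constructor <;> linarith [hti.1, hti.2, htj.1, htj.2]
    calc ‖D i j (φ (P.tag i) - φ (Q.tag j))‖ ≤ ‖D i j‖ * ‖φ (P.tag i) - φ (Q.tag j)‖ :=
          (D i j).le_opNorm _
      _ ≤ ‖D i j‖ * ε := by gcongr
      _ = ε * ‖D i j‖ := mul_comm _ _
  have hvar : ∑ i ∈ Finset.range P.n, ∑ j ∈ Finset.range Q.n, ENNReal.ofReal ‖D i j‖ ≤
      eVariationOn μ (Icc a b) := by
    have h1 : ∀ i, ∑ j ∈ Finset.range Q.n, ENNReal.ofReal ‖D i j‖ ≤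
        eVariationOn μ (Icc (P.pt i) (P.pt (i + 1))) := by
      intro i
      have := eVariationOn.sum_le (f := μ) (s := Icc (P.pt i) (P.pt (i + 1))) (n := Q.n)
        (u := fun j => clampIcc (P.pt i) (P.pt (i + 1)) (Q.pt j))
        (fun j k hjk => clampIcc_mono (Q.mono hjk)) (fun j => clampIcc_mem (hPm i) _)
      refine le_trans (le_of_eq (Finset.sum_congr rfl fun j _ => ?_)) this
      rw [edist_eq_enorm_sub, ofReal_norm]
    refine (Finset.sum_le_sum fun i _ => h1 i).trans ?_
    rw [eVariationOn.sum' μ P.mono, P.pt_zero, P.pt_n]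
  have hvar' : ∑ i ∈ Finset.range P.n, ∑ j ∈ Finset.range Q.n, ‖D i j‖ ≤
      (eVariationOn μ (Icc a b)).toReal := by
    rw [← ENNReal.ofReal_le_iff_le_toReal hμ]
    rw [ENNReal.ofReal_sum_of_nonneg fun i _ => Finset.sum_nonneg fun j _ => norm_nonneg _]
    refine le_trans (le_of_eq (Finset.sum_congr rfl fun i _ => ?_)) hvar
    exact ENNReal.ofReal_sum_of_nonneg fun j _ => norm_nonneg _
  have hdiff : rsSum μ φ P - rsSum μ φ Q =
      ∑ i ∈ Finset.range P.n, ∑ j ∈ Finset.range Q.n, D i j (φ (P.tag i) - φ (Q.tag j)) := by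
    rw [hsP, hsQ]
    simp only [map_sub, Finset.sum_sub_distrib]
  rw [hdiff]
  calc _ ≤ ∑ i ∈ Finset.range P.n, ∑ j ∈ Finset.range Q.n, ε * ‖D i j‖ := by
        refine norm_sum_le_of_le _ fun i hi => norm_sum_le_of_le _ fun j hj => ?_
        exact hterm i (Finset.mem_range.1 hi) j (Finset.mem_range.1 hj)
    _ = ε * ∑ i ∈ Finset.range P.n, ∑ j ∈ Finset.range Q.n, ‖D i j‖ := by
        simp only [Finset.mul_sum]
    _ ≤ _ := by gcongr

/-- Continuous functions are Riemann–Stieltjes integrable against functions of bounded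
variation. -/
theorem hasRSIntegral_rsIntegral [CompleteSpace X] {μ : ℝ → X →L[ℂ] X} {φ : ℝ → X} {a b : ℝ}
    (hab : a ≤ b) (hμ : BoundedVariationOn μ (Icc a b)) (hφ : ContinuousOn φ (Icc a b)) :
    HasRSIntegral μ φ a b (rsIntegral μ φ a b) := by
  set V := (eVariationOn μ (Icc a b)).toReal with hV
  have hV0 : 0 ≤ V := ENNReal.toReal_nonneg
  have key : ∀ ε > 0, ∃ δ > 0, ∀ P Q : TaggedDivision a b, P.MeshLT δ → Q.MeshLT δ →
      ‖rsSum μ φ P - rsSum μ φ Q‖ < ε := by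
    intro ε hε
    have huc := isCompact_Icc.uniformContinuousOn_of_continuous hφ
    rw [Metric.uniformContinuousOn_iff] at huc
    obtain ⟨δ, hδ, h⟩ := huc (ε / (V + 1)) (by positivity)
    refine ⟨δ / 2, by positivity, fun P Q hP hQ => ?_⟩
    have := norm_rsSum_sub_le hμ (ε := ε / (V + 1)) (δ := δ / 2) (by positivity)
      (fun x hx y hy hxy => by
        have := h x hx y hy (by rw [Real.dist_eq]; linarith)
        rw [dist_eq_norm] at this
        exact this.le) hP hQ
    refine this.trans_lt ?_
    rw [div_mul_eq_mul_div, div_lt_iff₀ (by positivity)]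
    nlinarith
  have hex : ∃ y, HasRSIntegral μ φ a b y := by
    have hc : CauchySeq fun n => rsSum μ φ (equalDivision hab n) := by
      rw [Metric.cauchySeq_iff]
      intro ε hε
      obtain ⟨δ, hδ, h⟩ := key ε hε
      obtain ⟨N, hN⟩ := exists_equalDivision_meshLT hab hδ
      refine ⟨N, fun m hm n hn => ?_⟩
      rw [dist_eq_norm]
      exact h _ _ (hN m hm) (hN n hn)
    obtain ⟨y, hy⟩ := cauchySeq_tendsto_of_complete hc
    refine ⟨y, fun ε hε => ?_⟩
    obtain ⟨δ, hδ, h⟩ := key (ε / 2) (half_pos hε)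
    refine ⟨δ, hδ, fun P hP => ?_⟩
    obtain ⟨N, hN⟩ := exists_equalDivision_meshLT hab hδ
    obtain ⟨N', hN'⟩ := (Metric.tendsto_atTop.1 hy) (ε / 2) (half_pos hε)
    have e₁ := h P _ hP (hN (max N N') (le_max_left _ _))
    have e₂ := hN' (max N N') (le_max_right _ _)
    rw [dist_eq_norm] at e₂
    have := norm_sub_le_norm_sub_add_norm_sub (rsSum μ φ P)
      (rsSum μ φ (equalDivision hab (max N N'))) y
    linarith
  rw [rsIntegral, dif_pos hex]
  exact hex.choose_spec

end Stieltjes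

/-! ### Sobolev spaces `W^{1,p}` on an interval -/

section Sobolev

/-- Nondegenerate intervals containing the base point `0`, such as `[0, ∞)` and `[-r, 0]`. -/
structure IsTimeInterval (s : Set ℝ) : Prop where
  ordConnected : s.OrdConnected
  zero_mem : (0 : ℝ) ∈ s
  subset_closure_interior : s ⊆ closure (interior s)

lemma isTimeInterval_Ici : IsTimeInterval (Ici (0 : ℝ)) where
  ordConnected := ordConnected_Ici
  zero_mem := self_mem_Ici
  subset_closure_interior := by rw [interior_Ici, closure_Ioi]

lemma isTimeInterval_Icc {r : ℝ} (hr : 0 < r) : IsTimeInterval (Icc (-r) 0) where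
  ordConnected := ordConnected_Icc
  zero_mem := ⟨by linarith, le_rfl⟩
  subset_closure_interior := by
    rw [interior_Icc, closure_Ioo (by linarith)]

variable {X : Type*} [NormedAddCommGroup X] [NormedSpace ℂ X] {p : ℝ≥0∞} [Fact (1 ≤ p)]
  {s : Set ℝ}

lemma IsTimeInterval.uIcc_subset (hs : IsTimeInterval s) {a b : ℝ} (ha : a ∈ s) (hb : b ∈ s) :
    uIcc a b ⊆ s := hs.ordConnected.uIcc_subset ha hb

lemma IsTimeInterval.intervalIntegrable (hs : IsTimeInterval s)
    (g : Lp X p (volume.restrict s)) {a b : ℝ} (ha : a ∈ s) (hb : b ∈ s) :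
    IntervalIntegrable g volume a b := by
  rw [intervalIntegrable_iff]
  have hsub : uIoc a b ⊆ s := uIoc_subset_uIcc.trans (hs.uIcc_subset ha hb)
  have : IsFiniteMeasure (volume.restrict (uIoc a b)) := ⟨by simp [uIoc]⟩
  exact ((Lp.memLp g).mono_measure (Measure.restrict_mono hsub le_rfl)).integrable Fact.out

/-- `f = c + ∫_0^· g` almost everywhere on `s`. -/
def IsPrimitive (s : Set ℝ) (f g : Lp X p (volume.restrict s)) (c : X) : Prop :=
  ∀ᵐ t ∂(volume.restrict s), f t = c + ∫ u in (0 : ℝ)..t, g u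

lemma integral_congr_Lp (hs : IsTimeInterval s) {g h : ℝ → X}
    (hgh : g =ᵐ[volume.restrict s] h) {a t : ℝ} (ha : a ∈ s) (ht : t ∈ s) :
    ∫ u in a..t, g u = ∫ u in a..t, h u := by
  refine intervalIntegral.integral_congr_ae ?_
  have hsub : uIoc a t ⊆ s := uIoc_subset_uIcc.trans (hs.uIcc_subset ha ht)
  have := ae_restrict_of_ae_restrict_of_subset hsub hgh
  exact (ae_restrict_iff' measurableSet_uIoc).1 this

lemma IsTimeInterval.measurableSet (hs : IsTimeInterval s) : MeasurableSet s :=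
  hs.ordConnected.measurableSet

lemma IsPrimitive.add (hs : IsTimeInterval s) {f f' g g' : Lp X p (volume.restrict s)} {c c' : X}
    (h : IsPrimitive s f g c) (h' : IsPrimitive s f' g' c') :
    IsPrimitive s (f + f') (g + g') (c + c') := by
  filter_upwards [h, h', Lp.coeFn_add f f', ae_restrict_mem hs.measurableSet] with t h1 h2 h3 ht
  rw [integral_congr_Lp hs (Lp.coeFn_add g g') hs.zero_mem ht, h3]
  simp only [Pi.add_apply]
  rw [intervalIntegral.integral_add (hs.intervalIntegrable g hs.zero_mem ht)
    (hs.intervalIntegrable g' hs.zero_mem ht), h1, h2]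
  abel

lemma IsPrimitive.smul (hs : IsTimeInterval s) {f g : Lp X p (volume.restrict s)} {c : X} (k : ℂ)
    (h : IsPrimitive s f g c) : IsPrimitive s (k • f) (k • g) (k • c) := by
  filter_upwards [h, Lp.coeFn_smul k f, ae_restrict_mem hs.measurableSet] with t h1 h3 ht
  rw [integral_congr_Lp hs (Lp.coeFn_smul k g) hs.zero_mem ht, h3]
  simp only [Pi.smul_apply]
  rw [intervalIntegral.integral_smul, h1, smul_add]

lemma isPrimitive_zero (hs : IsTimeInterval s) :
    IsPrimitive s (0 : Lp X p (volume.restrict s)) 0 0 := by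
  simpa using (IsPrimitive.smul hs (0 : ℂ) (f := (0 : Lp X p (volume.restrict s))) (g := 0)
    (c := (0 : X)) (by
      filter_upwards [Lp.coeFn_zero X p (volume.restrict s),
        ae_restrict_mem hs.measurableSet] with t h1 ht
      rw [integral_congr_Lp hs (Lp.coeFn_zero X p (volume.restrict s)) hs.zero_mem ht, h1]
      simp))

lemma continuousOn_primitive (hs : IsTimeInterval s) (g : Lp X p (volume.restrict s)) (c : X) :
    ContinuousOn (fun t => c + ∫ u in (0 : ℝ)..t, g u) s := by
  intro t ht
  obtain ⟨a, ha, ha0, hat⟩ : ∃ a ∈ s, a ≤ 0 ∧ Ici a ∈ 𝓝[s] t := by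
    by_cases h : ∃ a ∈ s, a < t
    · obtain ⟨a, ha, hat⟩ := h
      refine ⟨min a 0, ?_, min_le_right _ _, ?_⟩
      · rcases min_choice a 0 with h | h <;> rw [h]
        exacts [ha, hs.zero_mem]
      · exact mem_nhdsWithin_of_mem_nhds (Ici_mem_nhds ((min_le_left _ _).trans_lt hat))
    · push Not at h
      exact ⟨t, ht, h 0 hs.zero_mem, mem_of_superset self_mem_nhdsWithin h⟩
  obtain ⟨b, hb, hb0, hbt⟩ : ∃ b ∈ s, 0 ≤ b ∧ Iic b ∈ 𝓝[s] t := by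
    by_cases h : ∃ b ∈ s, t < b
    · obtain ⟨b, hb, hbt⟩ := h
      refine ⟨max b 0, ?_, le_max_right _ _, ?_⟩
      · rcases max_choice b 0 with h | h <;> rw [h]
        exacts [hb, hs.zero_mem]
      · exact mem_nhdsWithin_of_mem_nhds (Iic_mem_nhds (hbt.trans_le (le_max_left _ _)))
    · push Not at h
      exact ⟨t, ht, h 0 hs.zero_mem, mem_of_superset self_mem_nhdsWithin h⟩
  have hmem : uIcc a b ∈ 𝓝[s] t := by
    rw [uIcc_of_le (ha0.trans hb0)]
    exact inter_mem hat hbt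
  have hc := intervalIntegral.continuousOn_primitive_interval' (hs.intervalIntegrable g ha hb)
    (a := 0) (by rw [uIcc_of_le (ha0.trans hb0)]; exact ⟨ha0, hb0⟩)
  exact continuousWithinAt_const.add ((hc t (mem_of_mem_nhdsWithin ht hmem)).mono_of_mem_nhdsWithin
    hmem)

/-- The initial value and the weak derivative are determined by the function. -/
lemma IsPrimitive.unique (hs : IsTimeInterval s) {f g g' : Lp X p (volume.restrict s)} {c c' : X}
    [CompleteSpace X] (h : IsPrimitive s f g c) (h' : IsPrimitive s f g' c') : g = g' ∧ c = c' := by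
  have hae : (fun t => c + ∫ u in (0 : ℝ)..t, g u) =ᵐ[volume.restrict s]
      (fun t => c' + ∫ u in (0 : ℝ)..t, g' u) := by
    filter_upwards [h, h'] with t h1 h2
    rw [← h1, ← h2]
  have heq : EqOn (fun t => c + ∫ u in (0 : ℝ)..t, g u) (fun t => c' + ∫ u in (0 : ℝ)..t, g' u) s :=
    Measure.eqOn_of_ae_eq hae (continuousOn_primitive hs g c) (continuousOn_primitive hs g' c')
      hs.subset_closure_interior
  have hcc : c = c' := by simpa using heq hs.zero_mem
  refine ⟨?_, hcc⟩
  have hint : ∀ t ∈ s, ∫ u in (0 : ℝ)..t, g u = ∫ u in (0 : ℝ)..t, g' u := by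
    intro t ht
    simpa [hcc] using heq ht
  have hint' : ∀ a ∈ s, ∀ t ∈ s, ∫ u in a..t, g u = ∫ u in a..t, g' u := by
    intro a ha t ht
    rw [← intervalIntegral.integral_interval_sub_left (hs.intervalIntegrable g hs.zero_mem ht)
      (hs.intervalIntegrable g hs.zero_mem ha), hint t ht, hint a ha,
      intervalIntegral.integral_interval_sub_left (hs.intervalIntegrable g' hs.zero_mem ht)
      (hs.intervalIntegrable g' hs.zero_mem ha)]
  have hrat : ∀ a b : ℚ, ∀ᵐ x : ℝ, (a : ℝ) ∈ s → (b : ℝ) ∈ s → x ∈ Ioo (a : ℝ) b → g x = g' x := by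
    intro a b
    by_cases hab : (a : ℝ) ∈ s ∧ (b : ℝ) ∈ s
    · filter_upwards [(hs.intervalIntegrable g hab.1 hab.2).ae_hasDerivAt_integral,
        (hs.intervalIntegrable g' hab.1 hab.2).ae_hasDerivAt_integral] with x h1 h2 ha hb hx
      have hxm : x ∈ uIcc (a : ℝ) b := Icc_subset_uIcc ⟨hx.1.le, hx.2.le⟩
      have d1 := h1 hxm a left_mem_uIcc
      have d2 := h2 hxm a left_mem_uIcc
      refine d1.unique (d2.congr_of_eventuallyEq ?_)
      filter_upwards [Ioo_mem_nhds hx.1 hx.2] with y hy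
      exact hint' a ha y (hs.ordConnected.out ha hb ⟨hy.1.le, hy.2.le⟩)
    · exact Eventually.of_forall fun x ha hb => absurd ⟨ha, hb⟩ hab
  have hall : ∀ᵐ x : ℝ, ∀ a b : ℚ, (a : ℝ) ∈ s → (b : ℝ) ∈ s → x ∈ Ioo (a : ℝ) b → g x = g' x :=
    ae_all_iff.2 fun a => ae_all_iff.2 fun b => hrat a b
  have hfr : ∀ᵐ x : ℝ, x ∉ frontier s := by
    have : volume (frontier s) = 0 := (hs.ordConnected.convex).addHaar_frontier volume
    exact measure_eq_zero_iff_ae_notMem.1 this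
  refine Lp.ext ?_
  refine (ae_restrict_iff' hs.measurableSet).2 ?_
  filter_upwards [hall, hfr] with x hx hxf hxs
  have hxi : x ∈ interior s := by
    by_contra hni
    exact hxf ⟨subset_closure hxs, hni⟩
  obtain ⟨l, u, hlu, hsub⟩ := mem_nhds_iff_exists_Ioo_subset.1 (mem_interior_iff_mem_nhds.1 hxi)
  obtain ⟨a, hla, hax⟩ := exists_rat_btwn hlu.1
  obtain ⟨b, hxb, hbu⟩ := exists_rat_btwn hlu.2
  exact hx a b (hsub ⟨hla, hax.trans hlu.2⟩) (hsub ⟨hlu.1.trans hxb, hbu⟩) ⟨hax, hxb⟩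

variable (X p)

/-- The Sobolev space `W^{1,p}(s, X)`: the `f ∈ L^p(s, X)` for which there are `c ∈ X` and
`g ∈ L^p(s, X)` with `f(t) = c + ∫_0^t g(u) du` for almost every `t ∈ s`. -/
def sobolev (hs : IsTimeInterval s) : Submodule ℂ (Lp X p (volume.restrict s)) where
  carrier := {f | ∃ (g : Lp X p (volume.restrict s)) (c : X), IsPrimitive s f g c}
  add_mem' := by
    rintro f f' ⟨g, c, h⟩ ⟨g', c', h'⟩
    exact ⟨g + g', c + c', h.add hs h'⟩
  zero_mem' := ⟨0, 0, isPrimitive_zero hs⟩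
  smul_mem' := by
    rintro k f ⟨g, c, h⟩
    exact ⟨k • g, k • c, h.smul hs k⟩

variable {X p} [CompleteSpace X]

lemma sobolev_spec (hs : IsTimeInterval s) (f : sobolev X p hs) :
    IsPrimitive s f.1 f.2.choose f.2.choose_spec.choose :=
  f.2.choose_spec.choose_spec

/-- The weak derivative `f' = g` of `f = c + ∫_0^· g`. -/
def weakDeriv (hs : IsTimeInterval s) : sobolev X p hs →ₗ[ℂ] Lp X p (volume.restrict s) where
  toFun f := f.2.choose
  map_add' f f' := ((sobolev_spec hs (f + f')).unique hs
    ((sobolev_spec hs f).add hs (sobolev_spec hs f'))).1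
  map_smul' k f := ((sobolev_spec hs (k • f)).unique hs ((sobolev_spec hs f).smul hs k)).1

/-- The point evaluation `δ₀ f = f(0) = c` of `f = c + ∫_0^· g`. -/
def evalZero (hs : IsTimeInterval s) : sobolev X p hs →ₗ[ℂ] X where
  toFun f := f.2.choose_spec.choose
  map_add' f f' := ((sobolev_spec hs (f + f')).unique hs
    ((sobolev_spec hs f).add hs (sobolev_spec hs f'))).2
  map_smul' k f := ((sobolev_spec hs (k • f)).unique hs ((sobolev_spec hs f).smul hs k)).2

/-- The continuous representative `t ↦ f(0) + ∫_0^t f'(u) du` of `f ∈ W^{1,p}(s, X)`. -/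
def contRep (hs : IsTimeInterval s) (f : sobolev X p hs) (t : ℝ) : X :=
  evalZero hs f + ∫ u in (0 : ℝ)..t, weakDeriv hs f u

lemma contRep_ae_eq (hs : IsTimeInterval s) (f : sobolev X p hs) :
    ∀ᵐ t ∂(volume.restrict s), (f : Lp X p (volume.restrict s)) t = contRep hs f t :=
  sobolev_spec hs f

lemma continuousOn_contRep (hs : IsTimeInterval s) (f : sobolev X p hs) :
    ContinuousOn (contRep hs f) s :=
  continuousOn_primitive hs _ _

lemma contRep_add (hs : IsTimeInterval s) (f f' : sobolev X p hs) {t : ℝ} (ht : t ∈ s) :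
    contRep hs (f + f') t = contRep hs f t + contRep hs f' t := by
  simp only [contRep, map_add]
  rw [integral_congr_Lp hs (Lp.coeFn_add _ _) hs.zero_mem ht]
  simp only [Pi.add_apply]
  rw [intervalIntegral.integral_add (hs.intervalIntegrable _ hs.zero_mem ht)
    (hs.intervalIntegrable _ hs.zero_mem ht)]
  abel

lemma contRep_smul (hs : IsTimeInterval s) (k : ℂ) (f : sobolev X p hs) {t : ℝ} (ht : t ∈ s) :
    contRep hs (k • f) t = k • contRep hs f t := by
  simp only [contRep, map_smul]
  rw [integral_congr_Lp hs (Lp.coeFn_smul _ _) hs.zero_mem ht]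
  simp only [Pi.smul_apply]
  rw [intervalIntegral.integral_smul, smul_add]

end Sobolev

/-! ### Unbounded operators and semigroups -/

section Operators

variable {E : Type*} [NormedAddCommGroup E] [NormedSpace ℂ E]

/-- A strongly continuous semigroup `(T(t))_{t ≥ 0}` of bounded operators (only `t ≥ 0` matters). -/
structure IsC0Semigroup (T : ℝ → E →L[ℂ] E) : Prop where
  zero : T 0 = 1
  add : ∀ t s : ℝ, 0 ≤ t → 0 ≤ s → T (t + s) = T t * T s
  continuousOn : ∀ x, ContinuousOn (fun t => T t x) (Ici 0)

/-- `A` is the generator of some strongly continuous semigroup: `x ∈ D(A)` with `A x = y` exactly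
when `(T(h) x - x) / h → y` as `h → 0+`. -/
def IsC0Generator (A : E →ₗ.[ℂ] E) : Prop :=
  ∃ T : ℝ → E →L[ℂ] E, IsC0Semigroup T ∧
    ∀ x y : E, (x, y) ∈ A.graph ↔
      Tendsto (fun h : ℝ => (h⁻¹ : ℂ) • (T h x - x)) (𝓝[>] 0) (𝓝 y)

/-- The resolvent set of an unbounded operator: `λ` such that `λ - T : D(T) → E` has a bounded
everywhere defined inverse `R`. By the closed graph theorem, on a Banach space this means that `T`
is closed and `λ - T` is bijective, see `mem_resolventSet_iff`. -/
def resolventSet (T : E →ₗ.[ℂ] E) : Set ℂ :=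
  {z | ∃ R : E →L[ℂ] E, (∀ y, ∃ h : R y ∈ T.domain, z • R y - T ⟨R y, h⟩ = y) ∧
    ∀ x : T.domain, R (z • (x : E) - T x) = x}

lemma mem_resolventSet_iff [CompleteSpace E] {T : E →ₗ.[ℂ] E} {z : ℂ} :
    z ∈ resolventSet T ↔
      T.IsClosed ∧ Function.Bijective (fun x : T.domain => z • (x : E) - T x) := by
  constructor
  · rintro ⟨R, h1, h2⟩
    have hg : (T.graph : Set (E × E)) = {q | R (z • q.1 - q.2) = q.1} := by
      ext ⟨x, y⟩
      simp only [SetLike.mem_coe, LinearPMap.mem_graph_iff, mem_ofPred_eq]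
      constructor
      · rintro ⟨w, rfl, rfl⟩
        exact h2 w
      · intro h
        obtain ⟨hd, he⟩ := h1 (z • x - y)
        refine ⟨⟨_, hd⟩, h, ?_⟩
        have h' : z • R (z • x - y) = z • x := by rw [h]
        rw [h'] at he
        exact sub_right_injective he
    refine ⟨?_, fun x x' h => ?_, fun y => ?_⟩
    · rw [LinearPMap.IsClosed, hg]
      exact isClosed_eq (R.continuous.comp ((continuous_fst.const_smul z).sub continuous_snd))
        continuous_fst
    · have := congrArg R h
      simp only [h2] at this
      exact Subtype.ext this
    · obtain ⟨hd, he⟩ := h1 y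
      exact ⟨⟨_, hd⟩, he⟩
  · rintro ⟨hcl, hbij⟩
    let N : T.domain →ₗ[ℂ] E := z • T.domain.subtype - T.toFun
    let e : T.domain ≃ₗ[ℂ] E := LinearEquiv.ofBijective N hbij
    have he : ∀ x : T.domain, e x = z • (x : E) - T x := fun x => rfl
    let R₀ : E →ₗ[ℂ] E := T.domain.subtype ∘ₗ e.symm.toLinearMap
    have hR₀ : ∀ y, R₀ y = (e.symm y : E) := fun y => rfl
    have hgr : IsClosed (R₀.graph : Set (E × E)) := by
      have : (R₀.graph : Set (E × E)) =
          (fun q : E × E => (q.2, z • q.2 - q.1)) ⁻¹' (T.graph : Set (E × E)) := by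
        ext ⟨y, x⟩
        simp only [SetLike.mem_coe, LinearMap.mem_graph_iff, mem_preimage,
          LinearPMap.mem_graph_iff, hR₀]
        constructor
        · rintro rfl
          refine ⟨e.symm y, rfl, ?_⟩
          have h := he (e.symm y)
          rw [e.apply_symm_apply] at h
          rw [eq_sub_iff_add_eq, add_comm, ← eq_sub_iff_add_eq.1 h]
        · rintro ⟨w, rfl, hw⟩
          have : e w = y := by rw [he, hw]; abel
          rw [← this, e.symm_apply_apply]
      rw [this]
      exact hcl.preimage (continuous_snd.prodMk ((continuous_snd.const_smul z).sub continuous_fst))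
    refine ⟨⟨R₀, R₀.continuous_of_isClosed_graph hgr⟩, fun y => ⟨(e.symm y).2, ?_⟩, fun x => ?_⟩
    · have := he (e.symm y)
      rw [e.apply_symm_apply] at this
      exact this.symm
    · change ((e.symm (z • (x : E) - T x) : T.domain) : E) = x
      rw [← he, e.symm_apply_apply]

end Operators

/-! ### The operators of the delay integro-differential equation -/

section Delay

variable {X : Type*} [NormedAddCommGroup X] [NormedSpace ℂ X] [CompleteSpace X]
  {p : ℝ≥0∞} [Fact (1 ≤ p)]

/-- `L^p(ℝ₊, X)`. -/
abbrev LpHalfLine (X : Type*) [NormedAddCommGroup X] (p : ℝ≥0∞) : Type _ :=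
  Lp X p (volume.restrict (Ici (0 : ℝ)))

/-- `L^p([-r, 0], X)`. -/
abbrev LpHistory (X : Type*) [NormedAddCommGroup X] (p : ℝ≥0∞) (r : ℝ) : Type _ :=
  Lp X p (volume.restrict (Icc (-r) (0 : ℝ)))

/-- The Laplace transform `â(z) = ∫_0^∞ e^{-zt} a(t) dt`. -/
def laplace (a : LpHalfLine ℂ p) (z : ℂ) : ℂ :=
  ∫ t in Ici (0 : ℝ), Complex.exp (-z * t) * a t

/-- The map `y ↦ a(·) y` from `X` to `L^p(ℝ₊, X)`. -/
def kernelMul (a : LpHalfLine ℂ p) : X →ₗ[ℂ] LpHalfLine X p where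
  toFun y := (ContinuousLinearMap.toSpanSingleton ℂ y).compLp a
  map_add' y y' := by
    refine Lp.ext ?_
    filter_upwards [(ContinuousLinearMap.toSpanSingleton ℂ (y + y')).coeFn_compLp a,
      (ContinuousLinearMap.toSpanSingleton ℂ y).coeFn_compLp a,
      (ContinuousLinearMap.toSpanSingleton ℂ y').coeFn_compLp a,
      Lp.coeFn_add ((ContinuousLinearMap.toSpanSingleton ℂ y).compLp a)
        ((ContinuousLinearMap.toSpanSingleton ℂ y').compLp a)] with t h1 h2 h3 h4
    rw [h4, Pi.add_apply, h1, h2, h3]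
    simp
  map_smul' k y := by
    refine Lp.ext ?_
    filter_upwards [(ContinuousLinearMap.toSpanSingleton ℂ (k • y)).coeFn_compLp a,
      (ContinuousLinearMap.toSpanSingleton ℂ y).coeFn_compLp a,
      Lp.coeFn_smul k ((ContinuousLinearMap.toSpanSingleton ℂ y).compLp a)] with t h1 h2 h3
    rw [RingHom.id_apply, h3, Pi.smul_apply, h1, h2]
    simp [smul_comm k]

lemma kernelMul_ae_eq (a : LpHalfLine ℂ p) (y : X) :
    ∀ᵐ t ∂(volume.restrict (Ici (0 : ℝ))), kernelMul a y t = a t • y := by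
  filter_upwards [(ContinuousLinearMap.toSpanSingleton ℂ y).coeFn_compLp a] with t h
  exact h.trans (by simp)

variable (p) in
/-- The operator matrix `[[A, δ₀], [0, d/ds]]` on `X × L^p(ℝ₊, X)` with domain
`D(A) × W^{1,p}(ℝ₊, X)`. -/
def volterraOpZero (A : X →ₗ.[ℂ] X) : X × LpHalfLine X p →ₗ.[ℂ] X × LpHalfLine X p where
  domain := A.domain.prod (sobolev X p isTimeInterval_Ici)
  toFun :=
    { toFun := fun w =>
        (A ⟨w.1.1, w.2.1⟩ + evalZero isTimeInterval_Ici ⟨w.1.2, w.2.2⟩,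
          weakDeriv isTimeInterval_Ici ⟨w.1.2, w.2.2⟩)
      map_add' := fun w w' => by
        have h1 := A.map_add ⟨w.1.1, w.2.1⟩ ⟨w'.1.1, w'.2.1⟩
        have h2 := (evalZero isTimeInterval_Ici).map_add ⟨w.1.2, w.2.2⟩ ⟨w'.1.2, w'.2.2⟩
        have h3 := (weakDeriv isTimeInterval_Ici).map_add ⟨w.1.2, w.2.2⟩ ⟨w'.1.2, w'.2.2⟩
        refine Prod.ext ?_ h3
        refine (congrArg₂ (· + ·) h1 h2).trans ?_
        simp only [Prod.fst_add]
        abel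
      map_smul' := fun k w => by
        have h1 := A.map_smul k ⟨w.1.1, w.2.1⟩
        have h2 := (evalZero isTimeInterval_Ici).map_smul k ⟨w.1.2, w.2.2⟩
        have h3 := (weakDeriv isTimeInterval_Ici).map_smul k ⟨w.1.2, w.2.2⟩
        refine Prod.ext ?_ h3
        refine (congrArg₂ (· + ·) h1 h2).trans ?_
        simp }

/-- The operator matrix `[[A, δ₀], [a(·)A, d/ds]]` on `X × L^p(ℝ₊, X)` with domain
`D(A) × W^{1,p}(ℝ₊, X)`. -/
def volterraOp (A : X →ₗ.[ℂ] X) (a : LpHalfLine ℂ p) :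
    X × LpHalfLine X p →ₗ.[ℂ] X × LpHalfLine X p where
  domain := A.domain.prod (sobolev X p isTimeInterval_Ici)
  toFun :=
    { toFun := fun w =>
        (A ⟨w.1.1, w.2.1⟩ + evalZero isTimeInterval_Ici ⟨w.1.2, w.2.2⟩,
          kernelMul a (A ⟨w.1.1, w.2.1⟩) + weakDeriv isTimeInterval_Ici ⟨w.1.2, w.2.2⟩)
      map_add' := fun w w' => by
        have h1 := A.map_add ⟨w.1.1, w.2.1⟩ ⟨w'.1.1, w'.2.1⟩
        have h2 := (evalZero isTimeInterval_Ici).map_add ⟨w.1.2, w.2.2⟩ ⟨w'.1.2, w'.2.2⟩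
        have h3 := (weakDeriv isTimeInterval_Ici).map_add ⟨w.1.2, w.2.2⟩ ⟨w'.1.2, w'.2.2⟩
        have h4 := (congrArg (kernelMul a) h1).trans ((kernelMul a).map_add _ _)
        refine Prod.ext ((congrArg₂ (· + ·) h1 h2).trans ?_) ((congrArg₂ (· + ·) h4 h3).trans ?_)
        · simp only [Prod.fst_add]
          abel
        · simp only [Prod.snd_add]
          abel
      map_smul' := fun k w => by
        have h1 := A.map_smul k ⟨w.1.1, w.2.1⟩
        have h2 := (evalZero isTimeInterval_Ici).map_smul k ⟨w.1.2, w.2.2⟩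
        have h3 := (weakDeriv isTimeInterval_Ici).map_smul k ⟨w.1.2, w.2.2⟩
        have h4 := (congrArg (kernelMul a) h1).trans ((kernelMul a).map_smul k _)
        refine Prod.ext ((congrArg₂ (· + ·) h1 h2).trans ?_) ((congrArg₂ (· + ·) h4 h3).trans ?_)
        · simp
        · simp }

lemma rsIntegral_add {μ : ℝ → X →L[ℂ] X} {φ ψ χ : ℝ → X} {a b : ℝ} (hab : a ≤ b)
    (hμ : BoundedVariationOn μ (Icc a b)) (hφ : ContinuousOn φ (Icc a b))
    (hψ : ContinuousOn ψ (Icc a b)) (hχ : ∀ t ∈ Icc a b, χ t = φ t + ψ t) :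
    rsIntegral μ χ a b = rsIntegral μ φ a b + rsIntegral μ ψ a b :=
  (((hasRSIntegral_rsIntegral hab hμ hφ).add (hasRSIntegral_rsIntegral hab hμ hψ)).congr
    fun t ht => (hχ t ht).symm).rsIntegral_eq hab

lemma rsIntegral_smul {μ : ℝ → X →L[ℂ] X} {φ χ : ℝ → X} {a b : ℝ} (hab : a ≤ b)
    (hμ : BoundedVariationOn μ (Icc a b)) (hφ : ContinuousOn φ (Icc a b)) (k : ℂ)
    (hχ : ∀ t ∈ Icc a b, χ t = k • φ t) :
    rsIntegral μ χ a b = k • rsIntegral μ φ a b :=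
  (((hasRSIntegral_rsIntegral hab hμ hφ).smul k).congr
    fun t ht => (hχ t ht).symm).rsIntegral_eq hab

/-- The delay operator `L φ = ∫_{-r}^0 dμ(θ) φ(θ)` on `W^{1,p}([-r, 0], X)`. -/
def delayOp {r : ℝ} (hr : 0 < r) {μ : ℝ → X →L[ℂ] X}
    (hμ : BoundedVariationOn μ (Icc (-r) 0)) :
    sobolev X p (isTimeInterval_Icc hr) →ₗ[ℂ] X where
  toFun φ := rsIntegral μ (contRep (isTimeInterval_Icc hr) φ) (-r) 0
  map_add' φ ψ := rsIntegral_add (by linarith) hμ (continuousOn_contRep _ φ)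
    (continuousOn_contRep _ ψ) fun _ ht => contRep_add _ φ ψ ht
  map_smul' k φ := rsIntegral_smul (by linarith) hμ (continuousOn_contRep _ φ) k
    fun _ ht => contRep_smul _ k φ ht

/-- The operator `L e_z : X → X`, `x ↦ L (e_z x) = ∫_{-r}^0 dμ(θ) e^{zθ} x`. -/
def delayExpOp {r : ℝ} (hr : 0 < r) {μ : ℝ → X →L[ℂ] X}
    (hμ : BoundedVariationOn μ (Icc (-r) 0)) (z : ℂ) : X →ₗ[ℂ] X where
  toFun x := rsIntegral μ (fun θ => Complex.exp (z * θ) • x) (-r) 0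
  map_add' x y := rsIntegral_add (by linarith) hμ (by fun_prop) (by fun_prop)
    fun _ _ => smul_add _ _ _
  map_smul' k x := rsIntegral_smul (by linarith) hμ (by fun_prop) k
    fun _ _ => smul_comm _ _ _

/-- The operator `𝔄_L` on `(X × L^p(ℝ₊, X)) × L^p([-r, 0], X)`: it sends `((x, f), φ)` to
`((A x + f(0) + L φ, a(·) A x + f'), φ')`, with domain all `((x, f), φ)` such that `x ∈ D(A)`,
`f ∈ W^{1,p}(ℝ₊, X)`, `φ ∈ W^{1,p}([-r, 0], X)` and `φ(0) = x`. -/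
def delayGenerator (A : X →ₗ.[ℂ] X) (a : LpHalfLine ℂ p) {r : ℝ} (hr : 0 < r)
    {μ : ℝ → X →L[ℂ] X} (hμ : BoundedVariationOn μ (Icc (-r) 0)) :
    (X × LpHalfLine X p) × LpHistory X p r →ₗ.[ℂ] (X × LpHalfLine X p) × LpHistory X p r where
  domain :=
    { carrier := {z | z.1 ∈ (volterraOp A a).domain ∧
        ∃ h : z.2 ∈ sobolev X p (isTimeInterval_Icc hr),
          evalZero (isTimeInterval_Icc hr) ⟨z.2, h⟩ = z.1.1}
      add_mem' := by
        rintro z z' ⟨h1, h2, h3⟩ ⟨h1', h2', h3'⟩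
        refine ⟨add_mem h1 h1', add_mem h2 h2', ?_⟩
        have := (evalZero (isTimeInterval_Icc hr)).map_add ⟨z.2, h2⟩ ⟨z'.2, h2'⟩
        refine this.trans ?_
        rw [h3, h3']
        rfl
      zero_mem' := ⟨zero_mem _, zero_mem _, (evalZero (isTimeInterval_Icc hr)).map_zero⟩
      smul_mem' := by
        rintro k z ⟨h1, h2, h3⟩
        refine ⟨Submodule.smul_mem _ k h1, Submodule.smul_mem _ k h2, ?_⟩
        have := (evalZero (isTimeInterval_Icc hr)).map_smul k ⟨z.2, h2⟩
        refine this.trans ?_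
        rw [h3]
        rfl }
  toFun :=
    { toFun := fun z =>
        (volterraOp A a ⟨z.1.1, z.2.1⟩ + (delayOp hr hμ ⟨z.1.2, z.2.2.1⟩, 0),
          weakDeriv (isTimeInterval_Icc hr) ⟨z.1.2, z.2.2.1⟩)
      map_add' := fun z z' => by
        have h1 := (volterraOp A a).map_add ⟨z.1.1, z.2.1⟩ ⟨z'.1.1, z'.2.1⟩
        have h2 := (delayOp (p := p) hr hμ).map_add ⟨z.1.2, z.2.2.1⟩ ⟨z'.1.2, z'.2.2.1⟩
        have h3 := (weakDeriv (isTimeInterval_Icc hr)).map_add ⟨z.1.2, z.2.2.1⟩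
          ⟨z'.1.2, z'.2.2.1⟩
        have h4 : ∀ u v : X, ((u + v, 0) : X × LpHalfLine X p) = (u, 0) + (v, 0) := by simp
        refine Prod.ext ?_ h3
        refine (congrArg₂ (· + ·) h1 ((congrArg (fun u => (u, 0)) h2).trans (h4 _ _))).trans ?_
        simp only [Prod.fst_add]
        abel
      map_smul' := fun k z => by
        have h1 := (volterraOp A a).map_smul k ⟨z.1.1, z.2.1⟩
        have h2 := (delayOp (p := p) hr hμ).map_smul k ⟨z.1.2, z.2.2.1⟩
        have h3 := (weakDeriv (isTimeInterval_Icc hr)).map_smul k ⟨z.1.2, z.2.2.1⟩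
        have h4 : ∀ u : X, ((k • u, 0) : X × LpHalfLine X p) = k • (u, 0) := by simp
        refine Prod.ext ?_ h3
        refine (congrArg₂ (· + ·) h1 ((congrArg (fun u => (u, 0)) h2).trans (h4 _))).trans ?_
        simp }

end Delay

end DelayVolterra

end

set_option linter.unusedSectionVars false

open Set Filter Topology MeasureTheory
open scoped ENNReal

noncomputable section

namespace DelayVolterra


/-! ### Absolute continuity and the product rule -/

section ProductRule

variable {X : Type*} [NormedAddCommGroup X] [NormedSpace ℂ X]

/-! The resolvent equation of `𝔄_L` with right side `((y, g), ψ)` is solved by eliminating one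
component after another. The history row `z φ - φ' = ψ` with `φ(0) = x` is a linear ODE on a bounded
interval. Its unique solution is `historySol`, which depends boundedly on `(x, ψ)`. Hence `L φ` is a
bounded function of `(x, ψ)` (`delayHistoryOp`), and its value at `(x, 0)` is `L e_z x`. What
remains (`mem_graph_delayGenerator`) is the resolvent equation of `𝒜^{δ₀}` with `y + L φ` in place
of `y`.

If `g = 0`, the memory row is `z f - f' = a(·) A x`. For `Re z > 0` this forces `f(0) = â(z) A x`,
because `e^{-zt} f(t)` vanishes at infinity (`evalZero_eq_integral`). The first row becomes `z x -
(1 + â(z)) A x - L e_z x = y` when `ψ = 0`. Conversely, `z ∈ ρ(𝒜₀)` supplies an `f` solving the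
memory row. This is `exists_mem_graph_volterraOp_add_iff`, and it carries both implications.

From `𝔄_L` to the reduced operator, the inverse is the corner of the big resolvent that takes `((y,
0), 0)` to its `X` component. In the other direction a general `g` is removed by subtracting the
`𝒜^{δ₀}` resolvent at `(0, g)`. The shifted unknown satisfies the reduced equation, and the full
solution is then assembled from bounded operators. -/

/-- The indefinite Bochner integral of an interval integrable function is absolutely continuous. -/
lemma absolutelyContinuousOnInterval_integral {g : ℝ → X} {a b : ℝ}
    (hg : IntervalIntegrable g volume a b) :
    AbsolutelyContinuousOnInterval (fun t => ∫ u in a..t, g u) a b := by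
  -- Increments of the vector integral are dominated by those of the scalar primitive of `‖g‖`, so
  -- the scalar `δ` serves.
  have hn := (absolutelyContinuousOnInterval_iff _ _ _).1
    (hg.norm.absolutelyContinuousOnInterval_intervalIntegral (left_mem_uIcc (a := a) (b := b)))
  refine (absolutelyContinuousOnInterval_iff _ _ _).2 fun ε hε => ?_
  obtain ⟨δ, hδ, h⟩ := hn ε hε
  refine ⟨δ, hδ, fun E hE hEδ => (Finset.sum_le_sum fun i hi => ?_).trans_lt (h E hE hEδ)⟩
  have hmem := hE.1 i hi
  have i1 : IntervalIntegrable g volume a (E.2 i).1 :=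
    hg.mono_set (uIcc_subset_uIcc left_mem_uIcc hmem.1)
  have i2 : IntervalIntegrable g volume a (E.2 i).2 :=
    hg.mono_set (uIcc_subset_uIcc left_mem_uIcc hmem.2)
  rw [dist_eq_norm, Real.dist_eq, intervalIntegral.integral_interval_sub_left i1 i2,
    intervalIntegral.integral_interval_sub_left i1.norm i2.norm]
  exact intervalIntegral.norm_integral_le_abs_integral_norm

variable [CompleteSpace X]

/-- Product rule for an exponential and an absolutely continuous function. -/
lemma exp_smul_primitive (w : ℂ) (c : X) {g : ℝ → X} {t : ℝ}
    (hg : IntervalIntegrable g volume 0 t) :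
    Complex.exp (w * t) • (c + ∫ u in (0 : ℝ)..t, g u) =
      c + ∫ s in (0 : ℝ)..t,
        Complex.exp (w * s) • (g s + w • (c + ∫ u in (0 : ℝ)..s, g u)) := by
  set G : ℝ → X := fun s => c + ∫ u in (0 : ℝ)..s, g u with hGdef
  have hexp : Continuous fun s : ℝ => Complex.exp (w * s) := by fun_prop
  have hG : AbsolutelyContinuousOnInterval G 0 t := by
    have hc : AbsolutelyContinuousOnInterval (fun _ : ℝ => c) 0 t :=
      (contDiff_const.contDiffOn).absolutelyContinuousOnInterval
    exact hc.add (absolutelyContinuousOnInterval_integral hg)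
  have hint : IntervalIntegrable (fun s => Complex.exp (w * s) • (g s + w • G s)) volume 0 t :=
    (hg.add (hG.continuousOn.intervalIntegrable.smul w)).continuousOn_smul hexp.continuousOn
  have hE : AbsolutelyContinuousOnInterval (fun s : ℝ => Complex.exp (w * s)) 0 t := by
    refine ContDiffOn.absolutelyContinuousOnInterval (ContDiff.contDiffOn ?_)
    exact (contDiff_const.mul Complex.ofRealCLM.contDiff).cexp
  -- The product minus the claimed integral is absolutely continuous with derivative zero almost
  -- everywhere, hence constant; its value at `0` is `c`.
  obtain ⟨C, hC⟩ := ((hE.smul hG).sub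
    (absolutelyContinuousOnInterval_integral hint)).const_of_ae_hasDerivAt_zero (by
      filter_upwards [hg.ae_hasDerivAt_integral, hint.ae_hasDerivAt_integral] with s h1 h2 hs
      have d1 := (h1 hs 0 left_mem_uIcc).const_add c
      have d2 := h2 hs 0 left_mem_uIcc
      have d3 : HasDerivAt (fun s : ℝ => Complex.exp (w * s)) (Complex.exp (w * s) * w) s := by
        have := ((Complex.ofRealCLM.hasDerivAt (x := s)).const_mul w).cexp
        simpa using this
      have := (d3.smul d1).sub d2
      convert! this using 1
      simp only [smul_add, smul_smul, hGdef]
      abel)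
  have e0 := hC 0 left_mem_uIcc
  have et := hC t right_mem_uIcc
  simp only [Pi.sub_apply, Pi.smul_apply', hGdef] at e0 et
  simp only [intervalIntegral.integral_same, Complex.ofReal_zero, mul_zero, Complex.exp_zero,
    one_smul, sub_zero, add_zero] at e0
  rw [← e0, sub_eq_iff_eq_add] at et
  exact et

end ProductRule

/-! ### Sobolev functions and variation of constants -/

section Primitive

variable {X : Type*} [NormedAddCommGroup X] [NormedSpace ℂ X] [CompleteSpace X]
  {p : ℝ≥0∞} [Fact (1 ≤ p)] {s : Set ℝ}

lemma IsPrimitive.mem_sobolev (hs : IsTimeInterval s) {f g : Lp X p (volume.restrict s)} {c : X}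
    (h : IsPrimitive s f g c) : f ∈ sobolev X p hs := ⟨g, c, h⟩

lemma IsPrimitive.weakDeriv_eq (hs : IsTimeInterval s) {f g : Lp X p (volume.restrict s)} {c : X}
    (h : IsPrimitive s f g c) : weakDeriv hs ⟨f, h.mem_sobolev hs⟩ = g :=
  ((sobolev_spec hs ⟨f, h.mem_sobolev hs⟩).unique hs h).1

lemma IsPrimitive.evalZero_eq (hs : IsTimeInterval s) {f g : Lp X p (volume.restrict s)} {c : X}
    (h : IsPrimitive s f g c) : evalZero hs ⟨f, h.mem_sobolev hs⟩ = c :=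
  ((sobolev_spec hs ⟨f, h.mem_sobolev hs⟩).unique hs h).2

/-- Variation of constants: `e^{-zt} f(t) = f(0) - ∫_0^t e^{-zs} (z f - f')(s) ds`. -/
lemma exp_smul_contRep (hs : IsTimeInterval s) (f : sobolev X p hs) (z : ℂ) {t : ℝ} (ht : t ∈ s) :
    Complex.exp (-z * t) • contRep hs f t = evalZero hs f -
      ∫ u in (0 : ℝ)..t, Complex.exp (-z * u) •
        (z • (f : Lp X p (volume.restrict s)) - weakDeriv hs f) u := by
  have h := exp_smul_primitive (-z) (evalZero hs f)
    (hs.intervalIntegrable (weakDeriv hs f) hs.zero_mem ht)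
  rw [contRep, h, sub_eq_add_neg, ← intervalIntegral.integral_neg]
  congr 1
  refine integral_congr_Lp hs ?_ hs.zero_mem ht
  filter_upwards [contRep_ae_eq hs f, Lp.coeFn_sub (z • (f : Lp X p (volume.restrict s)))
    (weakDeriv hs f), Lp.coeFn_smul z (f : Lp X p (volume.restrict s))] with u h1 h2 h3
  rw [h2, Pi.sub_apply, h3, Pi.smul_apply, h1, contRep, ← smul_neg]
  congr 1
  rw [neg_smul]
  abel

end Primitive


/-! ### Bounds for Riemann–Stieltjes integrals -/

section StieltjesBound

variable {X : Type*} [NormedAddCommGroup X] [NormedSpace ℂ X]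

lemma norm_rsSum_le {μ : ℝ → X →L[ℂ] X} {φ : ℝ → X} {a b : ℝ}
    (hμ : BoundedVariationOn μ (Icc a b)) {B : ℝ} (hB : 0 ≤ B) (hφ : ∀ t ∈ Icc a b, ‖φ t‖ ≤ B)
    (P : TaggedDivision a b) :
    ‖rsSum μ φ P‖ ≤ (eVariationOn μ (Icc a b)).toReal * B := by
  have hvar : ∑ i ∈ Finset.range P.n, ‖μ (P.pt (i + 1)) - μ (P.pt i)‖ ≤
      (eVariationOn μ (Icc a b)).toReal := by
    rw [← ENNReal.ofReal_le_iff_le_toReal hμ,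
      ENNReal.ofReal_sum_of_nonneg fun i _ => norm_nonneg _]
    refine le_trans (le_of_eq (Finset.sum_congr rfl fun i _ => ?_))
      (eVariationOn.sum_le_of_monotoneOn_Iic (f := μ) (s := Icc a b) (n := P.n) (u := P.pt)
        (P.mono.monotoneOn _) fun i hi => P.pt_mem hi)
    rw [edist_eq_enorm_sub, ofReal_norm]
  calc ‖rsSum μ φ P‖ ≤ ∑ i ∈ Finset.range P.n, ‖μ (P.pt (i + 1)) - μ (P.pt i)‖ * B := by
        refine norm_sum_le_of_le _ fun i hi => ?_
        have hi := Finset.mem_range.1 hi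
        have ht := P.tag_mem i hi
        exact (ContinuousLinearMap.le_opNorm _ _).trans (mul_le_mul_of_nonneg_left
          (hφ _ ⟨(P.pt_mem hi.le).1.trans ht.1, ht.2.trans (P.pt_mem hi).2⟩) (norm_nonneg _))
    _ ≤ _ := by
        rw [← Finset.sum_mul]
        gcongr

/-- The sums obey the bound and come within any `ε` of the integral. This turns sup bounds on
solutions of the history equation into operator bounds for `L`. -/
lemma norm_rsIntegral_le [CompleteSpace X] {μ : ℝ → X →L[ℂ] X} {φ : ℝ → X} {a b : ℝ} (hab : a ≤ b)
    (hμ : BoundedVariationOn μ (Icc a b)) (hc : ContinuousOn φ (Icc a b)) {B : ℝ} (hB : 0 ≤ B)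
    (hφ : ∀ t ∈ Icc a b, ‖φ t‖ ≤ B) :
    ‖rsIntegral μ φ a b‖ ≤ (eVariationOn μ (Icc a b)).toReal * B := by
  refine le_of_forall_pos_le_add fun ε hε => ?_
  obtain ⟨δ, hδ, h⟩ := hasRSIntegral_rsIntegral hab hμ hc ε hε
  obtain ⟨N, hN⟩ := exists_equalDivision_meshLT hab hδ
  have h1 := h _ (hN N le_rfl)
  have h2 := norm_rsSum_le hμ hB hφ (equalDivision hab N)
  rw [norm_sub_rev] at h1
  have h3 := norm_le_norm_add_norm_sub (rsSum μ φ (equalDivision hab N)) (rsIntegral μ φ a b)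
  rw [norm_sub_rev] at h3
  linarith

end StieltjesBound

/-! ### The history equation on `[-r, 0]` -/

section History

variable {X : Type*} [NormedAddCommGroup X] [NormedSpace ℂ X] [CompleteSpace X]
  {p : ℝ≥0∞} [Fact (1 ≤ p)] {r : ℝ}

/-- The solution `φ(t) = e^{zt} (x - ∫_0^t e^{-zs} ψ(s) ds)` of `z φ - φ' = ψ`, `φ(0) = x`. -/
def historySol (z : ℂ) (x : X) (ψ : ℝ → X) (t : ℝ) : X :=
  Complex.exp (z * t) • (x - ∫ s in (0 : ℝ)..t, Complex.exp (-z * s) • ψ s)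

lemma intervalIntegrable_exp_smul {s : Set ℝ} (hs : IsTimeInterval s) (z : ℂ)
    (ψ : Lp X p (volume.restrict s)) {t : ℝ} (ht : t ∈ s) :
    IntervalIntegrable (fun u : ℝ => Complex.exp (z * u) • ψ u) volume 0 t :=
  (hs.intervalIntegrable ψ hs.zero_mem ht).continuousOn_smul (by fun_prop)

/-- Representatives of a sum in `L^p` agree with the sum of representatives only almost everywhere,
but `ψ` enters through an integral, so additivity holds at every `t`. -/
lemma historySol_add (hr : 0 < r) (z : ℂ) (x x' : X) (ψ ψ' : LpHistory X p r) {t : ℝ}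
    (ht : t ∈ Icc (-r) 0) :
    historySol z (x + x') (ψ + ψ' : LpHistory X p r) t =
      historySol z x ψ t + historySol z x' ψ' t := by
  have hs := isTimeInterval_Icc hr
  have h : ∫ s in (0 : ℝ)..t, Complex.exp (-z * s) • (ψ + ψ' : LpHistory X p r) s =
      ∫ s in (0 : ℝ)..t, (Complex.exp (-z * s) • ψ s + Complex.exp (-z * s) • ψ' s) := by
    refine integral_congr_Lp hs ?_ hs.zero_mem ht
    filter_upwards [Lp.coeFn_add ψ ψ'] with u hu
    rw [hu, Pi.add_apply, smul_add]
  rw [historySol, h, intervalIntegral.integral_add (intervalIntegrable_exp_smul hs _ _ ht)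
    (intervalIntegrable_exp_smul hs _ _ ht), historySol, historySol, ← smul_add]
  congr 1
  abel

lemma historySol_smul (hr : 0 < r) (z k : ℂ) (x : X) (ψ : LpHistory X p r) {t : ℝ}
    (ht : t ∈ Icc (-r) 0) :
    historySol z (k • x) (k • ψ : LpHistory X p r) t = k • historySol z x ψ t := by
  have hs := isTimeInterval_Icc hr
  have h : ∫ s in (0 : ℝ)..t, Complex.exp (-z * s) • (k • ψ : LpHistory X p r) s =
      ∫ s in (0 : ℝ)..t, k • (Complex.exp (-z * s) • ψ s) := by
    refine integral_congr_Lp hs ?_ hs.zero_mem ht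
    filter_upwards [Lp.coeFn_smul k ψ] with u hu
    rw [hu, Pi.smul_apply, smul_comm]
  rw [historySol, h, intervalIntegral.integral_smul, ← smul_sub, historySol, smul_comm]

lemma historySol_zero (hr : 0 < r) (z : ℂ) (x : X) {t : ℝ} (ht : t ∈ Icc (-r) 0) :
    historySol z x (0 : LpHistory X p r) t = Complex.exp (z * t) • x := by
  have hs := isTimeInterval_Icc hr
  have h : ∫ s in (0 : ℝ)..t, Complex.exp (-z * s) • (0 : LpHistory X p r) s =
      ∫ s in (0 : ℝ)..t, (0 : X) := by
    refine integral_congr_Lp hs ?_ hs.zero_mem ht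
    filter_upwards [Lp.coeFn_zero X p (volume.restrict (Icc (-r) (0 : ℝ)))] with u hu
    rw [hu, Pi.zero_apply, smul_zero]
  rw [historySol, h, intervalIntegral.integral_zero, sub_zero]

lemma continuousOn_historySol (hr : 0 < r) (z : ℂ) (x : X) (ψ : LpHistory X p r) :
    ContinuousOn (historySol z x ψ) (Icc (-r) 0) := by
  have hs := isTimeInterval_Icc hr
  have h := (intervalIntegrable_exp_smul hs (-z) ψ
    (left_mem_Icc.2 (by linarith : -r ≤ 0))).symm
  have hc := intervalIntegral.continuousOn_primitive_interval' h right_mem_uIcc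
  rw [uIcc_of_le (by linarith : -r ≤ 0)] at hc
  exact ContinuousOn.smul (by fun_prop) (continuousOn_const.sub hc)

/-- On a bounded interval the `L^1` norm is dominated by the `L^p` norm. -/
lemma exists_integral_norm_le (r : ℝ) : ∃ K : ℝ, 0 ≤ K ∧ ∀ ψ : LpHistory X p r,
    ∫ s in Icc (-r) 0, ‖ψ s‖ ≤ K * ‖ψ‖ := by
  refine ⟨((volume.restrict (Icc (-r) (0 : ℝ))) univ ^ (1 / (1 : ℝ≥0∞).toReal - 1 / p.toReal)).toReal,
    ENNReal.toReal_nonneg, fun ψ => ?_⟩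
  have h1 := Lp.memLp ψ
  have hp : 1 ≤ p := Fact.out
  have h2 := eLpNorm_le_eLpNorm_mul_rpow_measure_univ hp h1.aestronglyMeasurable
  rw [integral_norm_eq_lintegral_enorm h1.aestronglyMeasurable, ← eLpNorm_one_eq_lintegral_enorm,
    Lp.norm_def, mul_comm, ← ENNReal.toReal_mul]
  refine ENNReal.toReal_mono (ENNReal.mul_ne_top h1.eLpNorm_ne_top ?_) h2
  refine ENNReal.rpow_ne_top_of_nonneg ?_ (measure_ne_top _ _)
  rw [sub_nonneg]
  -- For `p = ∞` the convention `(∞).toReal = 0` makes `1 / p.toReal` zero, which is the correct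
  -- Hölder exponent.
  by_cases hpt : p = ∞
  · simp [hpt]
  · have : (1 : ℝ) ≤ p.toReal := by
      simpa using ENNReal.toReal_mono hpt hp
    simpa using inv_le_one_of_one_le₀ this

/-- Both exponentials are at most `M = e^{|z| r}` on `[-r, 0]`, and the `L^1` norm of `ψ` is at most
`K ‖ψ‖`. A sup bound is what both later uses need: it yields an `L^p` bound for `historyOp`, and a
bound on `L φ`, which the `L^p` norm of `φ` does not control. -/
lemma exists_norm_historySol_le (hr : 0 < r) (z : ℂ) : ∃ C : ℝ, 0 ≤ C ∧
    ∀ (x : X) (ψ : LpHistory X p r), ∀ t ∈ Icc (-r) 0,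
      ‖historySol z x ψ t‖ ≤ C * ‖(x, ψ)‖ := by
  have hs := isTimeInterval_Icc hr
  obtain ⟨K, hK, hKb⟩ := exists_integral_norm_le (X := X) (p := p) r
  set M := Real.exp (‖z‖ * r) with hM
  have hM0 : 0 ≤ M := (Real.exp_pos _).le
  -- Stated for all `w` of modulus `‖z‖` so as to cover both `z` and `-z`.
  have hexp : ∀ w : ℂ, ‖w‖ = ‖z‖ → ∀ t ∈ Icc (-r) 0, ‖Complex.exp (w * t)‖ ≤ M := by
    intro w hw t ht
    refine (Complex.norm_exp_le_exp_norm _).trans (Real.exp_le_exp.2 ?_)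
    rw [norm_mul, hw, Complex.norm_real, Real.norm_eq_abs]
    exact mul_le_mul_of_nonneg_left (abs_le.2 ⟨ht.1, by linarith [ht.2]⟩) (norm_nonneg _)
  refine ⟨M * (1 + M * K), by positivity, fun x ψ t ht => ?_⟩
  have hψi : IntegrableOn ψ (Icc (-r) 0) := by
    have := (hs.intervalIntegrable ψ (left_mem_Icc.2 (by linarith : -r ≤ 0)) hs.zero_mem)
    rwa [intervalIntegrable_iff_integrableOn_Icc_of_le (by linarith)] at this
  have hI : ‖∫ s in (0 : ℝ)..t, Complex.exp (-z * s) • ψ s‖ ≤ M * (K * ‖ψ‖) := by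
    have hsub : uIoc 0 t ⊆ Icc (-r) 0 := uIoc_subset_uIcc.trans (hs.uIcc_subset hs.zero_mem ht)
    refine intervalIntegral.norm_integral_le_integral_norm_uIoc.trans ?_
    calc ∫ s in uIoc 0 t, ‖Complex.exp (-z * s) • ψ s‖ ≤ ∫ s in uIoc 0 t, M * ‖ψ s‖ := by
          refine setIntegral_mono_on ?_ ((hψi.mono_set hsub).norm.const_mul M) measurableSet_uIoc
            fun s hs' => ?_
          · exact (intervalIntegrable_iff.1 (intervalIntegrable_exp_smul hs (-z) ψ ht)).norm
          · rw [norm_smul]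
            exact mul_le_mul_of_nonneg_right (hexp _ (norm_neg z) s (hsub hs')) (norm_nonneg _)
      _ = M * ∫ s in uIoc 0 t, ‖ψ s‖ := integral_const_mul _ _
      _ ≤ M * ∫ s in Icc (-r) 0, ‖ψ s‖ := by
          refine mul_le_mul_of_nonneg_left ?_ hM0
          exact setIntegral_mono_set hψi.norm (Eventually.of_forall fun _ => norm_nonneg _)
            (Eventually.of_forall hsub)
      _ ≤ M * (K * ‖ψ‖) := mul_le_mul_of_nonneg_left (hKb ψ) hM0
  have hx : ‖x‖ ≤ ‖(x, ψ)‖ := norm_fst_le (x, ψ)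
  have hψ : ‖ψ‖ ≤ ‖(x, ψ)‖ := norm_snd_le (x, ψ)
  rw [historySol, norm_smul, mul_assoc]
  refine mul_le_mul (hexp z rfl t ht) ?_ (norm_nonneg _) hM0
  refine (norm_sub_le _ _).trans ?_
  have : M * (K * ‖ψ‖) ≤ M * (K * ‖(x, ψ)‖) := by gcongr
  nlinarith

lemma memLp_historySol (hr : 0 < r) (z : ℂ) (x : X) (ψ : LpHistory X p r) :
    MemLp (historySol z x ψ) p (volume.restrict (Icc (-r) 0)) := by
  obtain ⟨C, -, hCb⟩ := exists_norm_historySol_le (X := X) (p := p) hr z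
  refine MemLp.of_bound ((continuousOn_historySol hr z x ψ).aestronglyMeasurable
    measurableSet_Icc) (C * ‖(x, ψ)‖) ?_
  filter_upwards [ae_restrict_mem measurableSet_Icc] with t ht
  exact hCb x ψ t ht

/-- The bounded operator `(x, ψ) ↦ φ` solving `z φ - φ' = ψ`, `φ(0) = x`. -/
def historyOp (hr : 0 < r) (z : ℂ) : (X × LpHistory X p r) →L[ℂ] LpHistory X p r :=
  LinearMap.mkContinuousOfExistsBound
    { toFun := fun q => (memLp_historySol hr z q.1 q.2).toLp
      map_add' := fun q q' => by
        rw [← MemLp.toLp_add]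
        refine MemLp.toLp_congr _ _ ?_
        filter_upwards [ae_restrict_mem measurableSet_Icc] with t ht
        exact historySol_add hr z q.1 q'.1 q.2 q'.2 ht
      map_smul' := fun k q => by
        rw [RingHom.id_apply, ← MemLp.toLp_const_smul]
        refine MemLp.toLp_congr _ _ ?_
        filter_upwards [ae_restrict_mem measurableSet_Icc] with t ht
        exact historySol_smul hr z k q.1 q.2 ht }
    (by
      obtain ⟨C, hC, hCb⟩ := exists_norm_historySol_le (X := X) (p := p) hr z
      refine ⟨measureUnivNNReal (volume.restrict (Icc (-r) (0 : ℝ))) ^ p.toReal⁻¹ * C,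
        fun q => ?_⟩
      rw [mul_assoc]
      refine Lp.norm_le_of_ae_bound (by positivity) ?_
      filter_upwards [(memLp_historySol hr z q.1 q.2).coeFn_toLp,
        ae_restrict_mem measurableSet_Icc] with t h ht
      exact (congrArg norm h).trans_le (hCb q.1 q.2 t ht))

lemma historyOp_ae_eq (hr : 0 < r) (z : ℂ) (x : X) (ψ : LpHistory X p r) :
    ∀ᵐ t ∂(volume.restrict (Icc (-r) (0 : ℝ))),
      historyOp hr z (x, ψ) t = historySol z x ψ t :=
  (memLp_historySol hr z x ψ).coeFn_toLp

/-- The product rule with exponent `z` and integrand `-e^{-zs} ψ(s)`: the two exponentials cancel in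
the derivative, leaving `z φ - ψ`. -/
lemma isPrimitive_historyOp (hr : 0 < r) (z : ℂ) (x : X) (ψ : LpHistory X p r) :
    IsPrimitive (Icc (-r) 0) (historyOp hr z (x, ψ)) (z • historyOp hr z (x, ψ) - ψ) x := by
  have hs := isTimeInterval_Icc hr
  filter_upwards [historyOp_ae_eq hr z x ψ, ae_restrict_mem measurableSet_Icc] with t h1 ht
  have h := exp_smul_primitive z x (g := fun s => -(Complex.exp (-z * s) • ψ s))
    (intervalIntegrable_exp_smul hs (-z) ψ ht).neg
  simp only [intervalIntegral.integral_neg, ← sub_eq_add_neg] at h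
  rw [h1, historySol, h]
  congr 1
  refine integral_congr_Lp hs ?_ hs.zero_mem ht
  filter_upwards [historyOp_ae_eq hr z x ψ, Lp.coeFn_sub (z • historyOp hr z (x, ψ)) ψ,
    Lp.coeFn_smul z (historyOp hr z (x, ψ))] with u e1 e2 e3
  rw [e2, Pi.sub_apply, e3, Pi.smul_apply, e1, historySol, smul_add, smul_neg, smul_smul,
    ← Complex.exp_add, smul_comm]
  simp only [neg_mul, add_neg_cancel, Complex.exp_zero, one_smul]
  abel

/-- Variation of constants multiplied by `e^{zt}`. The identity is needed at every `t`, since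
Riemann–Stieltjes sums see point values. -/
lemma contRep_eq_historySol (hr : 0 < r) (z : ℂ) (φ : sobolev X p (isTimeInterval_Icc hr))
    {t : ℝ} (ht : t ∈ Icc (-r) 0) :
    contRep (isTimeInterval_Icc hr) φ t = historySol z (evalZero (isTimeInterval_Icc hr) φ)
      (z • (φ : LpHistory X p r) - weakDeriv (isTimeInterval_Icc hr) φ : LpHistory X p r) t := by
  rw [historySol, ← exp_smul_contRep _ φ z ht, smul_smul, ← Complex.exp_add]
  simp

/-- `z φ - φ' = ψ`, `φ(0) = x` has no other solution. -/
lemma eq_historyOp (hr : 0 < r) (z : ℂ) (φ : sobolev X p (isTimeInterval_Icc hr)) :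
    (φ : LpHistory X p r) = historyOp hr z (evalZero (isTimeInterval_Icc hr) φ,
      z • (φ : LpHistory X p r) - weakDeriv (isTimeInterval_Icc hr) φ) := by
  refine Lp.ext ?_
  filter_upwards [historyOp_ae_eq hr z (evalZero (isTimeInterval_Icc hr) φ)
    (z • (φ : LpHistory X p r) - weakDeriv (isTimeInterval_Icc hr) φ),
    contRep_ae_eq _ φ, ae_restrict_mem measurableSet_Icc] with t h1 h2 ht
  rw [h1, h2, contRep_eq_historySol hr z φ ht]

lemma historyOp_mem (hr : 0 < r) (z : ℂ) (q : X × LpHistory X p r) :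
    historyOp hr z q ∈ sobolev X p (isTimeInterval_Icc hr) :=
  (isPrimitive_historyOp hr z q.1 q.2).mem_sobolev _

lemma evalZero_historyOp (hr : 0 < r) (z : ℂ) (q : X × LpHistory X p r) :
    evalZero (isTimeInterval_Icc hr) ⟨historyOp hr z q, historyOp_mem hr z q⟩ = q.1 :=
  (isPrimitive_historyOp hr z q.1 q.2).evalZero_eq _

lemma weakDeriv_historyOp (hr : 0 < r) (z : ℂ) (q : X × LpHistory X p r) :
    weakDeriv (isTimeInterval_Icc hr) ⟨historyOp hr z q, historyOp_mem hr z q⟩ =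
      z • historyOp hr z q - q.2 :=
  (isPrimitive_historyOp hr z q.1 q.2).weakDeriv_eq _

lemma contRep_historyOp (hr : 0 < r) (z : ℂ) (q : X × LpHistory X p r) {t : ℝ}
    (ht : t ∈ Icc (-r) 0) :
    contRep (isTimeInterval_Icc hr) ⟨historyOp hr z q, historyOp_mem hr z q⟩ t =
      historySol z q.1 q.2 t := by
  rw [contRep_eq_historySol hr z _ ht, evalZero_historyOp, weakDeriv_historyOp]
  simp

/-- The bounded operator `(x, ψ) ↦ L φ`, where `z φ - φ' = ψ` and `φ(0) = x`. -/
def delayHistoryOp (hr : 0 < r) {μ : ℝ → X →L[ℂ] X} (hμ : BoundedVariationOn μ (Icc (-r) 0))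
    (z : ℂ) : (X × LpHistory X p r) →L[ℂ] X :=
  LinearMap.mkContinuousOfExistsBound
    (delayOp (p := p) hr hμ ∘ₗ (historyOp hr z).toLinearMap.codRestrict
      (sobolev X p (isTimeInterval_Icc hr)) (historyOp_mem hr z))
    (by
      obtain ⟨C, hC, hCb⟩ := exists_norm_historySol_le (X := X) (p := p) hr z
      refine ⟨(eVariationOn μ (Icc (-r) 0)).toReal * C, fun q => ?_⟩
      rw [mul_assoc]
      refine norm_rsIntegral_le (by linarith) hμ (continuousOn_contRep _ _) (by positivity)
        fun t ht => ?_
      exact (congrArg norm (contRep_historyOp hr z q ht)).trans_le (hCb q.1 q.2 t ht))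

lemma delayHistoryOp_apply (hr : 0 < r) {μ : ℝ → X →L[ℂ] X}
    (hμ : BoundedVariationOn μ (Icc (-r) 0)) (z : ℂ) (q : X × LpHistory X p r) :
    delayHistoryOp hr hμ z q = delayOp hr hμ ⟨historyOp hr z q, historyOp_mem hr z q⟩ := rfl

/-- The homogeneous history equation has the solution `e^{zt} x`; this is how `L e_z` enters the
reduced operator. -/
lemma delayHistoryOp_zero (hr : 0 < r) {μ : ℝ → X →L[ℂ] X}
    (hμ : BoundedVariationOn μ (Icc (-r) 0)) (z : ℂ) (x : X) :
    delayHistoryOp hr hμ z (x, (0 : LpHistory X p r)) = delayExpOp hr hμ z x := by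
  have hc := hasRSIntegral_rsIntegral (by linarith : -r ≤ 0) hμ (continuousOn_contRep
    (isTimeInterval_Icc hr) ⟨historyOp hr z (x, (0 : LpHistory X p r)), historyOp_mem hr z _⟩)
  refine ((hc.congr fun t ht => ?_).rsIntegral_eq (by linarith)).symm
  rw [contRep_historyOp hr z _ ht]
  exact historySol_zero hr z x ht

end History


/-! ### Laplace transforms on the half-line -/

section HalfLine

variable {X : Type*} [NormedAddCommGroup X] [NormedSpace ℂ X]
  {p : ℝ≥0∞} [Fact (1 ≤ p)]

/-- The modulus is `e^{-t Re z}`, bounded by `1` and with integrable powers. All `q ≠ 0` are allowed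
because `q` will be the exponent conjugate to `p`, for Hölder's inequality. -/
lemma memLp_exp_neg_mul {z : ℂ} (hz : 0 < z.re) {q : ℝ≥0∞} (hq : q ≠ 0) :
    MemLp (fun t : ℝ => Complex.exp (-z * t)) q (volume.restrict (Ici 0)) := by
  have hmeas : AEStronglyMeasurable (fun t : ℝ => Complex.exp (-z * t))
      (volume.restrict (Ici 0)) := by
    have : Continuous fun t : ℝ => Complex.exp (-z * t) := by fun_prop
    exact this.aestronglyMeasurable
  have hnorm : ∀ t : ℝ, ‖Complex.exp (-z * t)‖ = Real.exp (-z.re * t) := by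
    intro t
    rw [Complex.norm_exp]
    simp
  by_cases hqt : q = ∞
  · subst hqt
    refine memLp_top_of_bound hmeas 1 ?_
    filter_upwards [ae_restrict_mem measurableSet_Ici] with t ht
    have ht : 0 ≤ t := ht
    rw [hnorm, Real.exp_le_one_iff]
    nlinarith
  · rw [← integrable_norm_rpow_iff hmeas hq hqt]
    have hq0 : 0 < q.toReal := ENNReal.toReal_pos hq hqt
    have : IntegrableOn (fun t => Real.exp (-(z.re * q.toReal) * t)) (Ici 0) := by
      rw [integrableOn_Ici_iff_integrableOn_Ioi]
      exact exp_neg_integrableOn_Ioi 0 (by positivity)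
    refine this.congr_fun (fun t _ => ?_) measurableSet_Ici
    simp only [hnorm]
    rw [← Real.exp_mul]
    ring_nf

lemma integrable_exp_smul {z : ℂ} (hz : 0 < z.re) (f : LpHalfLine X p) :
    IntegrableOn (fun t : ℝ => Complex.exp (-z * t) • f t) (Ici 0) := by
  have hpq := ENNReal.HolderConjugate.conjExponent (p := p) Fact.out
  have hqp := hpq.symm
  exact memLp_one_iff_integrable.1 ((Lp.memLp f).smul
    (memLp_exp_neg_mul hz (ENNReal.HolderConjugate.ne_zero p.conjExponent p)))

variable [CompleteSpace X]

/-- The initial value of `f ∈ W^{1,p}(ℝ₊, X)` is the Laplace transform of `z f - f'` at `z`. -/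
lemma evalZero_eq_integral {z : ℂ} (hz : 0 < z.re) (f : sobolev X p isTimeInterval_Ici) :
    evalZero isTimeInterval_Ici f = ∫ t in Ici (0 : ℝ), Complex.exp (-z * t) •
      (z • (f : LpHalfLine X p) - weakDeriv isTimeInterval_Ici f) t := by
  set h : LpHalfLine X p := z • (f : LpHalfLine X p) - weakDeriv isTimeInterval_Ici f with hh
  have hF : IntegrableOn (fun t : ℝ => Complex.exp (-z * t) • contRep isTimeInterval_Ici f t)
      (Ici 0) := by
    refine (integrable_exp_smul hz (f : LpHalfLine X p)).congr ?_
    filter_upwards [contRep_ae_eq isTimeInterval_Ici f] with t ht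
    rw [ht]
  have hlim : Tendsto (fun t : ℝ => Complex.exp (-z * t) • contRep isTimeInterval_Ici f t) atTop
      -- The limit exists by letting `t → ∞` in the variation of constants formula.
      (𝓝 (evalZero isTimeInterval_Ici f - ∫ t in Ici (0 : ℝ), Complex.exp (-z * t) • h t)) := by
    have h1 := intervalIntegral_tendsto_integral_Ioi 0
      ((integrable_exp_smul hz h).mono_set Ioi_subset_Ici_self) tendsto_id
    rw [← integral_Ici_eq_integral_Ioi] at h1
    refine (h1.const_sub (evalZero isTimeInterval_Ici f)).congr' ?_
    filter_upwards [eventually_ge_atTop 0] with t ht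
    exact (exp_smul_contRep isTimeInterval_Ici f z ht).symm
  -- An integrable function with a limit at infinity has limit zero, since neighbourhoods of
  -- infinity have infinite measure.
  have hzero := IntegrableAtFilter.eq_zero_of_tendsto
    (l := atTop) (μ := volume) ⟨Ici 0, Ici_mem_atTop 0, hF⟩
    (fun s hs => by
      obtain ⟨b, hb⟩ := mem_atTop_sets.1 hs
      exact top_le_iff.1 ((Real.volume_Ici (a := b)).symm.le.trans (measure_mono hb))) hlim
  exact sub_eq_zero.1 hzero

lemma integral_exp_smul_kernelMul (a : LpHalfLine ℂ p) (z : ℂ) (y : X) :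
    ∫ t in Ici (0 : ℝ), Complex.exp (-z * t) • kernelMul a y t = laplace a z • y := by
  rw [laplace, ← integral_smul_const]
  refine integral_congr_ae ?_
  filter_upwards [kernelMul_ae_eq a y] with t ht
  rw [ht, smul_smul]

end HalfLine

/-! ### Elimination in the resolvent equations -/

section Resolvent

/-- The pair `(x, z x - y)` lies in the graph exactly when `x ∈ D(T)` and `(z - T) x = y`. In this
form existence and uniqueness become one equivalence, and eliminating a component is a rewriting of
graph membership without domain proofs. -/
lemma mem_resolventSet_iff_graph {E : Type*} [NormedAddCommGroup E] [NormedSpace ℂ E]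
    {T : E →ₗ.[ℂ] E} {z : ℂ} :
    z ∈ resolventSet T ↔
      ∃ R : E →L[ℂ] E, ∀ x y : E, (x, z • x - y) ∈ T.graph ↔ R y = x := by
  constructor
  · rintro ⟨R, h1, h2⟩
    refine ⟨R, fun x y => ⟨fun h => ?_, ?_⟩⟩
    · obtain ⟨w, hw, hv⟩ := (LinearPMap.mem_graph_iff T).1 h
      dsimp only at hw hv
      have := h2 w
      rwa [hv, hw, sub_sub_cancel] at this
    · rintro rfl
      obtain ⟨hd, he⟩ := h1 y
      exact (LinearPMap.mem_graph_iff T).2 ⟨⟨R y, hd⟩, rfl, by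
        dsimp only
        exact eq_sub_of_add_eq (by rw [add_comm]; exact (sub_eq_iff_eq_add.1 he).symm)⟩
  · rintro ⟨R, h⟩
    refine ⟨R, fun y => ?_, fun x => ?_⟩
    · obtain ⟨⟨w, hd⟩, hw, hv⟩ := (LinearPMap.mem_graph_iff T).1 ((h (R y) y).2 rfl)
      dsimp only at hw hv
      subst hw
      exact ⟨hd, by rw [hv, sub_sub_cancel]⟩
    · rw [← h, sub_sub_cancel]
      exact T.mem_graph x

variable {X : Type*} [NormedAddCommGroup X] [NormedSpace ℂ X] [CompleteSpace X]
  {p : ℝ≥0∞} [Fact (1 ≤ p)] {A : X →ₗ.[ℂ] X}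

lemma mem_graph_volterraOp {a : LpHalfLine ℂ p} {x u : X} {f v : LpHalfLine X p} :
    ((x, f), (u, v)) ∈ (volterraOp A a).graph ↔ ∃ y, (x, y) ∈ A.graph ∧
      ∃ hf : f ∈ sobolev X p isTimeInterval_Ici, y + evalZero isTimeInterval_Ici ⟨f, hf⟩ = u ∧
        kernelMul a y + weakDeriv isTimeInterval_Ici ⟨f, hf⟩ = v := by
  rw [LinearPMap.mem_graph_iff]
  constructor
  · rintro ⟨⟨⟨x', f'⟩, hx, hf⟩, hw, hv⟩
    dsimp only at hw hv
    obtain ⟨rfl, rfl⟩ := Prod.mk.inj hw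
    obtain ⟨h1, h2⟩ := Prod.mk.inj hv
    exact ⟨_, A.mem_graph ⟨x', hx⟩, hf, h1, h2⟩
  · rintro ⟨y, hy, hf, rfl, rfl⟩
    obtain ⟨⟨x', hx⟩, hxx, rfl⟩ := (LinearPMap.mem_graph_iff A).1 hy
    dsimp only at hxx
    subst hxx
    exact ⟨⟨(x', f), hx, hf⟩, rfl, rfl⟩

/-- If `z` is in the resolvent set of the operator matrix `[[A, δ₀], [0, d/ds]]`, then
`z f - f' = h` is solvable in `W^{1,p}(ℝ₊, X)`. -/
lemma exists_smul_sub_weakDeriv_eq {z : ℂ} (hz : z ∈ resolventSet (volterraOpZero p A))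
    (h : LpHalfLine X p) : ∃ f : sobolev X p isTimeInterval_Ici,
      z • (f : LpHalfLine X p) - weakDeriv isTimeInterval_Ici f = h := by
  obtain ⟨R, h1, -⟩ := hz
  obtain ⟨hd, he⟩ := h1 (0, h)
  exact ⟨⟨(R (0, h)).2, hd.2⟩, congrArg Prod.snd he⟩

/-- With zero second datum, the memory row makes `z f - f'` equal to `a(·) v`, where `v = A x`, and
its Laplace transform at `z` gives `f(0) = â(z) v`. Only the converse needs `z ∈ ρ(𝒜₀)`, to produce
`f` from `v`. -/
lemma exists_mem_graph_volterraOp_iff {a : LpHalfLine ℂ p} {z : ℂ} (hz : 0 < z.re)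
    (hz' : z ∈ resolventSet (volterraOpZero p A)) {x y : X} :
    (∃ f, ((x, f), z • (x, f) - (y, 0)) ∈ (volterraOp A a).graph) ↔
      ∃ v, (x, v) ∈ A.graph ∧ (1 + laplace a z) • v = z • x - y := by
  have key : ∀ (f : sobolev X p isTimeInterval_Ici) (v : X),
      z • (f : LpHalfLine X p) - weakDeriv isTimeInterval_Ici f = kernelMul a v →
        evalZero isTimeInterval_Ici f = laplace a z • v := by
    intro f v h
    rw [evalZero_eq_integral hz, h, integral_exp_smul_kernelMul]
  constructor
  · rintro ⟨f, hf⟩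
    obtain ⟨v, hv, hfs, h1, h2⟩ := mem_graph_volterraOp.1 hf
    refine ⟨v, hv, ?_⟩
    refine Eq.trans ?_ h1
    rw [key ⟨f, hfs⟩ v ?_, add_smul, one_smul]
    have h2' : kernelMul a v + weakDeriv isTimeInterval_Ici ⟨f, hfs⟩ = z • f - 0 := h2
    rw [sub_zero] at h2'
    rw [← h2', add_sub_cancel_right]
  · rintro ⟨v, hv, h⟩
    obtain ⟨f, hf⟩ := exists_smul_sub_weakDeriv_eq hz' (kernelMul a v)
    refine ⟨f, mem_graph_volterraOp.2 ⟨v, hv, f.2, ?_, ?_⟩⟩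
    · refine Eq.trans ?_ h
      rw [key f v hf, add_smul, one_smul]
    · change kernelMul a v + weakDeriv isTimeInterval_Ici f = z • (f : LpHalfLine X p) - 0
      rw [← hf]
      abel

variable {r : ℝ}

/-- The domain stays `D(A)` even for `k = 0`, so `1 + â(z) = 0` needs no separate treatment. -/
lemma mem_graph_add_toPMap {k : ℂ} {B : X →ₗ[ℂ] X} {x u : X} :
    (x, u) ∈ (k • A + B.toPMap ⊤).graph ↔ ∃ v, (x, v) ∈ A.graph ∧ k • v + B x = u := by
  rw [LinearPMap.mem_graph_iff]
  constructor
  · rintro ⟨⟨x', hx⟩, rfl, rfl⟩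
    exact ⟨_, A.mem_graph ⟨x', hx.1⟩, rfl⟩
  · rintro ⟨v, hv, rfl⟩
    obtain ⟨⟨x', hx⟩, rfl, rfl⟩ := (LinearPMap.mem_graph_iff A).1 hv
    exact ⟨⟨x', hx, Submodule.mem_top⟩, rfl, rfl⟩

lemma exists_mem_graph_volterraOp_add_iff {a : LpHalfLine ℂ p} {z : ℂ} (hz : 0 < z.re)
    (hz' : z ∈ resolventSet (volterraOpZero p A)) (B : X →ₗ[ℂ] X) {x y : X} :
    (∃ f, ((x, f), z • (x, f) - (y + B x, 0)) ∈ (volterraOp A a).graph) ↔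
      (x, z • x - y) ∈ ((1 + laplace a z) • A + B.toPMap ⊤).graph := by
  rw [exists_mem_graph_volterraOp_iff hz hz', mem_graph_add_toPMap]
  refine exists_congr fun v => and_congr_right fun _ => ?_
  rw [← sub_sub, eq_sub_iff_add_eq]

/-- The resolvent equation of the delay operator amounts to one for the operator matrix on
`X × L^p(ℝ₊, X)`, the history component being determined by the first one. -/
lemma mem_graph_delayGenerator {a : LpHalfLine ℂ p} (hr : 0 < r) {μ : ℝ → X →L[ℂ] X}
    (hμ : BoundedVariationOn μ (Icc (-r) 0)) (z : ℂ) {w w' : X × LpHalfLine X p}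
    {φ ψ : LpHistory X p r} :
    ((w, φ), z • (w, φ) - (w', ψ)) ∈ (delayGenerator A a hr hμ).graph ↔
      φ = historyOp hr z (w.1, ψ) ∧
        (w, z • w - (w' + (delayHistoryOp hr hμ z (w.1, ψ), 0))) ∈ (volterraOp A a).graph := by
  rw [LinearPMap.mem_graph_iff, LinearPMap.mem_graph_iff]
  constructor
  · rintro ⟨⟨⟨w₁, φ₁⟩, hd, hφ, h0⟩, hw, hv⟩
    dsimp only at hw hv h0
    obtain ⟨rfl, rfl⟩ := Prod.mk.inj hw
    have h1 : volterraOp A a ⟨w₁, hd⟩ + (delayOp hr hμ ⟨φ₁, hφ⟩, 0) = z • w₁ - w' :=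
      congrArg Prod.fst hv
    have h2 : weakDeriv (isTimeInterval_Icc hr) ⟨φ₁, hφ⟩ = z • φ₁ - ψ := congrArg Prod.snd hv
    -- Uniqueness for the history equation: `φ₁` must be the solution with its own data `(x, ψ)`.
    have h3 := eq_historyOp hr z ⟨φ₁, hφ⟩
    rw [h0, h2, sub_sub_cancel] at h3
    dsimp only at h3
    have h4 : delayHistoryOp hr hμ z (w₁.1, ψ) = delayOp hr hμ ⟨φ₁, hφ⟩ := by
      rw [delayHistoryOp_apply]
      congr 1
      exact Subtype.ext h3.symm
    exact ⟨h3, ⟨w₁, hd⟩, rfl, by dsimp only; rw [h4, ← sub_sub, ← h1, add_sub_cancel_right]⟩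
  · rintro ⟨rfl, ⟨w₁, hd⟩, rfl, hv⟩
    dsimp only at hv
    refine ⟨⟨(w₁, historyOp hr z (w₁.1, ψ)), hd, historyOp_mem hr z _,
      evalZero_historyOp hr z _⟩, rfl, Prod.ext ?_ ?_⟩
    · change volterraOp A a ⟨w₁, hd⟩ + (delayHistoryOp hr hμ z (w₁.1, ψ), 0) = z • w₁ - w'
      rw [hv]
      abel
    · exact weakDeriv_historyOp hr z (w₁.1, ψ)

lemma delayHistoryOp_eq_add (hr : 0 < r) {μ : ℝ → X →L[ℂ] X}
    (hμ : BoundedVariationOn μ (Icc (-r) 0)) (z : ℂ) (x : X) (ψ : LpHistory X p r) :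
    delayHistoryOp hr hμ z (x, ψ) = delayHistoryOp hr hμ z (0, ψ) + delayExpOp hr hμ z x := by
  rw [← delayHistoryOp_zero (p := p), ← map_add]
  simp

/-- Solving the reduced equation for `y` amounts to solving the full one for `((y, 0), 0)`, so
compressing the full resolvent to `X` gives the inverse. -/
theorem mem_resolventSet_reduced_of_delayGenerator {a : LpHalfLine ℂ p} (hr : 0 < r)
    {μ : ℝ → X →L[ℂ] X} (hμ : BoundedVariationOn μ (Icc (-r) 0)) {z : ℂ} (hz : 0 < z.re)
    (hz' : z ∈ resolventSet (volterraOpZero p A))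
    (h : z ∈ resolventSet (delayGenerator A a hr hμ)) :
    z ∈ resolventSet ((1 + laplace a z) • A + (delayExpOp hr hμ z).toPMap ⊤) := by
  obtain ⟨R, hR⟩ := mem_resolventSet_iff_graph.1 h
  let ι : X →L[ℂ] (X × LpHalfLine X p) × LpHistory X p r :=
    ContinuousLinearMap.inl ℂ _ _ ∘L ContinuousLinearMap.inl ℂ _ _
  let π : (X × LpHalfLine X p) × LpHistory X p r →L[ℂ] X :=
    ContinuousLinearMap.fst ℂ _ _ ∘L ContinuousLinearMap.fst ℂ _ _
  refine mem_resolventSet_iff_graph.2 ⟨π ∘L R ∘L ι, fun x y => ?_⟩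
  rw [← exists_mem_graph_volterraOp_add_iff hz hz']
  have key : ∀ f, ((x, f), z • (x, f) - (y + delayExpOp hr hμ z x, 0)) ∈ (volterraOp A a).graph ↔
      R ((y, 0), 0) = ((x, f), historyOp hr z (x, 0)) := by
    intro f
    rw [← hR, mem_graph_delayGenerator, delayHistoryOp_zero]
    simp
  constructor
  · rintro ⟨f, hf⟩
    exact congrArg (fun q => q.1.1) ((key f).1 hf)
  · intro hx
    -- The memory component is read off from the full solution; its history component is then forced
    -- by the history equation.
    refine ⟨(R ((y, 0), 0)).1.2, (key _).2 ?_⟩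
    have hx' : (R ((y, 0), 0)).1.1 = x := hx
    have h1 := ((mem_graph_delayGenerator hr hμ z (w := (R ((y, 0), 0)).1)
      (φ := (R ((y, 0), 0)).2)).1 ((hR _ _).2 rfl)).1
    rw [hx'] at h1
    exact Prod.ext (Prod.ext hx' rfl) h1

/-- After the history is eliminated, `x` must satisfy `x = (R₁ (y + L φ, g)).1`, where `φ` itself
depends on `x`. Splitting off `s = (R₁ (0, g)).1` leaves an equation for `x - s` with zero memory
datum, which is the reduced equation with right side `y + delayHistoryOp hr hμ z (s, ψ)`. Thus `ξ`
is the only possible `x`, and `W`, `Φ` recover the other components boundedly. -/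
theorem mem_resolventSet_delayGenerator_of_reduced {a : LpHalfLine ℂ p} (hr : 0 < r)
    {μ : ℝ → X →L[ℂ] X} (hμ : BoundedVariationOn μ (Icc (-r) 0)) {z : ℂ} (hz : 0 < z.re)
    (hz₁ : z ∈ resolventSet (volterraOp A a)) (hz₂ : z ∈ resolventSet (volterraOpZero p A))
    (h : z ∈ resolventSet ((1 + laplace a z) • A + (delayExpOp hr hμ z).toPMap ⊤)) :
    z ∈ resolventSet (delayGenerator A a hr hμ) := by
  obtain ⟨R₁, hR₁⟩ := mem_resolventSet_iff_graph.1 hz₁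
  obtain ⟨R, hR⟩ := mem_resolventSet_iff_graph.1 h
  let E := (X × LpHalfLine X p) × LpHistory X p r
  let Y : E →L[ℂ] X := ContinuousLinearMap.fst ℂ _ _ ∘L ContinuousLinearMap.fst ℂ _ _
  let G : E →L[ℂ] LpHalfLine X p := ContinuousLinearMap.snd ℂ _ _ ∘L ContinuousLinearMap.fst ℂ _ _
  let Ψ : E →L[ℂ] LpHistory X p r := ContinuousLinearMap.snd ℂ _ _
  let S : E →L[ℂ] X := ContinuousLinearMap.fst ℂ _ _ ∘L R₁ ∘L (0 : E →L[ℂ] X).prod G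
  let ξ : E →L[ℂ] X := S + R ∘L (Y + delayHistoryOp hr hμ z ∘L S.prod Ψ)
  let W : E →L[ℂ] X × LpHalfLine X p :=
    R₁ ∘L (Y + delayHistoryOp hr hμ z ∘L ξ.prod Ψ).prod G
  let Φ : E →L[ℂ] LpHistory X p r := historyOp hr z ∘L ξ.prod Ψ
  -- The fixed point equation for `x` has exactly the solution `ξ`; one direction gives uniqueness
  -- of the full solution, the other existence.
  have key : ∀ (x y : X) (g : LpHalfLine X p) (ψ : LpHistory X p r),
      (R₁ (y + delayHistoryOp hr hμ z (x, ψ), g)).1 = x ↔ ξ ((y, g), ψ) = x := by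
    intro x y g ψ
    set s := S ((y, g), ψ) with hs
    have hs' : s = (R₁ (0, g)).1 := rfl
    have h1 : ξ ((y, g), ψ) = s + R (y + delayHistoryOp hr hμ z (s, ψ)) := rfl
    have h2 : y + delayHistoryOp hr hμ z (x, ψ) =
        y + delayHistoryOp hr hμ z (s, ψ) + delayExpOp hr hμ z (x - s) := by
      rw [delayHistoryOp_eq_add hr hμ z x, delayHistoryOp_eq_add hr hμ z s, map_sub]
      abel
    have h3 : R₁ (y + delayHistoryOp hr hμ z (x, ψ), g) =
        R₁ (0, g) + R₁ (y + delayHistoryOp hr hμ z (x, ψ), 0) := by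
      rw [← map_add]
      simp
    -- Both sides become statements about `x - s`; the term `L e_z (x - s)` split off in `h2` is
    -- what the reduced operator absorbs.
    rw [h1, h3, Prod.fst_add, ← hs', ← eq_sub_iff_add_eq', ← eq_sub_iff_add_eq', h2, ← hR,
      ← exists_mem_graph_volterraOp_add_iff hz hz₂]
    simp only [hR₁]
    exact ⟨fun hx => ⟨_, Prod.ext hx rfl⟩, fun ⟨f, hf⟩ => congrArg Prod.fst hf⟩
  refine mem_resolventSet_iff_graph.2 ⟨W.prod Φ, ?_⟩
  rintro ⟨⟨x, f⟩, φ⟩ ⟨⟨y, g⟩, ψ⟩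
  have hW : (W.prod Φ) ((y, g), ψ) =
      (R₁ (y + delayHistoryOp hr hμ z (ξ ((y, g), ψ), ψ), g),
        historyOp hr z (ξ ((y, g), ψ), ψ)) := rfl
  rw [mem_graph_delayGenerator, hR₁, hW, Prod.mk_add_mk, add_zero]
  dsimp only
  constructor
  · rintro ⟨rfl, hx⟩
    rw [(key x y g ψ).1 (congrArg Prod.fst hx), hx]
  · intro hq
    obtain ⟨h1, h2⟩ := Prod.mk.inj hq
    have h3 : ξ ((y, g), ψ) = x := ((key _ y g ψ).2 rfl).symm.trans (congrArg Prod.fst h1)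
    rw [h3] at h1 h2
    exact ⟨h2.symm, h1⟩

end Resolvent

end DelayVolterra

end

theorem mainTheorem4 {X : Type*} [NormedAddCommGroup X] [NormedSpace ℂ X] [CompleteSpace X]
    {p : ℝ≥0∞} [Fact (1 ≤ p)] (hp1 : 1 < p) (hp : p < ∞)
    -- `A` generates a strongly continuous semigroup on `X`
    (A : X →ₗ.[ℂ] X) (hA : DelayVolterra.IsC0Generator A)
    -- the kernel `a ∈ W^{1,p}(ℝ₊, ℂ)`
    (a : DelayVolterra.LpHalfLine ℂ p)
    (ha : a ∈ DelayVolterra.sobolev ℂ p DelayVolterra.isTimeInterval_Ici)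
    -- the delay measure `μ : [-r, 0] → ℒ(X)`
    {r : ℝ} (hr : 0 < r) (μ : ℝ → X →L[ℂ] X) (hμ : BoundedVariationOn μ (Icc (-r) 0))
    (hμ_cont : ContinuousWithinAt μ (Icc (-r) 0) 0)
    (hμ_zero : Tendsto (fun ε : ℝ => eVariationOn μ (Icc (-ε) 0)) (𝓝[>] 0) (𝓝 0))
    (z : ℂ) (hz : 0 < z.re)
    (hz1 : z ∈ DelayVolterra.resolventSet (DelayVolterra.volterraOp A a))
    (hz2 : z ∈ DelayVolterra.resolventSet (DelayVolterra.volterraOpZero p A)) :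
    z ∈ DelayVolterra.resolventSet (DelayVolterra.delayGenerator A a hr hμ) ↔
      z ∈ DelayVolterra.resolventSet ((1 + DelayVolterra.laplace a z) • A +
        (DelayVolterra.delayExpOp hr hμ z).toPMap ⊤) :=
  ⟨DelayVolterra.mem_resolventSet_reduced_of_delayGenerator hr hμ hz hz2,
    DelayVolterra.mem_resolventSet_delayGenerator_of_reduced hr hμ hz hz1 hz2⟩
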